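/- **Theorem (Uniqueness).** Let $n\ge 1$ and let $\Omega\subset\mathbb{R}^n$ be a bounded domain (open, connected, nonempty) with piecewise smooth boundary: outside a set of vanishing $(n-1)$-dimensional Hausdorff measure, $\partial\Omega$ is locally a $C^1$ hypersurface with $\Omega$ on one side; $\widehat{\mathbf n}$ denotes the unit outward normal at such points. Let $\mu>0$, $\beta>0$ and $\gamma$ be real constants and $\mathbf b:\Omega\to\mathbb{R}^n$ a given field. For $i=1,2$ let $\phi_i>0$ be a porosity on $\overline\Omega$, let $\mathbf K_i(\mathbf x)$, $\mathbf x\in\Omega$, be positive definite (not necessarily symmetric) tensors, put $\rho_i=\phi_i\gamma$, let $\partial\Omega=\Gamma_i^v\cup\Gamma_i^p$ with $\Gamma_i^v\cap\Gamma_i^p=\emptyset$, and let $v_{ni}$ on $\Gamma_i^v$ and $p_{0i}$ on $\Gamma_i^p$ be given functions. A classical solution of the steady double porosity/permeability model is a tuple $(\mathbf v_1,\mathbf v_2,p_1,p_2,\chi)$ such that $p_i$ and $\phi_i\mathbf v_i$ belong to $C^1(\Omega)\cap C(\overline\Omega)$ for $i=1,2$ and $$\mu\phi_i^2\mathbf K_i^{-1}\mathbf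 v_i+\phi_i\,\mathrm{grad}[p_i]=\rho_i\mathbf b\ \text{ in }\Omega\quad(i=1,2),$$ $$\mathrm{div}[\phi_1\mathbf v_1]=+\chi,\qquad \mathrm{div}[\phi_2\mathbf v_2]=-\chi,\qquad \chi=-\frac{\beta}{\mu}(p_1-p_2)\ \text{ in }\Omega,$$ $$\mathbf v_i\cdot\widehat{\mathbf n}=v_{ni}\ \text{ on }\Gamma_i^v\text{ wherever }\widehat{\mathbf n}\text{ is defined},\qquad p_i=p_{0i}\ \text{ on }\Gamma_i^p\quad(i=1,2).$$ Let $(\mathbf v_1,\mathbf v_2,p_1,p_2,\chi)$ and $(\mathbf v_1',\mathbf v_2',p_1',p_2',\chi')$ be two classical solutions for the same data. Then $\mathbf v_1=\mathbf v_1'$ and $\mathbf v_2=\mathbf v_2'$ on $\overline\Omega$, $\chi=\chi'$ in $\Omega$, and there is one constant $c\in\mathbb{R}$ with $p_1=p_1'+c$ and $p_2=p_2'+c$ on $\overline\Omega$. If moreover $\Gamma_1^p\cup\Gamma_2^p\neq\emptyset$, then also $p_1=p_1'$ and $p_2=p_2'$ on $\overline\Omega$. -/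

import Mathlib

open Set Filter Topology MeasureTheory

noncomputable section

namespace DoublePorosity

/-- The space `ℝⁿ` with its Euclidean norm and inner product. -/
abbrev Space (n : ℕ) := EuclideanSpace ℝ (Fin n)

/-- The divergence `∑ⱼ ∂ⱼ Fⱼ` of a vector field. -/
def divergence {n : ℕ} (F : Space n → Space n) (x : Space n) : ℝ :=
  ∑ j : Fin n, (fderiv ℝ F x (EuclideanSpace.single j 1)) j

/-- `ν` is the unit outward normal to `Ω` at the boundary point `x`: near `x`, the set `Ω` is
the sublevel set `{g < 0}` of a `C¹` function `g` with `∇g(x) ≠ 0` (so that `∂Ω` is a `C¹`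
hypersurface near `x` with `Ω` on one side), and `ν = ∇g(x) / ‖∇g(x)‖`. -/
def IsOutwardUnitNormal {n : ℕ} (Ω : Set (Space n)) (x ν : Space n) : Prop :=
  x ∈ frontier Ω ∧
    ∃ g : Space n → ℝ, ContDiffAt ℝ 1 g x ∧ gradient g x ≠ 0 ∧
      (∀ᶠ y in 𝓝 x, (y ∈ Ω ↔ g y < 0)) ∧ ν = ‖gradient g x‖⁻¹ • gradient g x

/-- The boundary of `Ω` is piecewise smooth: apart from a set of vanishing `(n-1)`-dimensional
Hausdorff measure (edges, corners), it is locally a `C¹` hypersurface with `Ω` on one side.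
The exceptional set is automatically closed. -/
def HasPiecewiseSmoothBoundary {n : ℕ} (Ω : Set (Space n)) : Prop :=
  μH[(n : ℝ) - 1] {x ∈ frontier Ω | ¬ ∃ ν, IsOutwardUnitNormal Ω x ν} = 0

/-- A (not necessarily symmetric) positive definite second-order tensor. -/
def IsPositiveDefinite {n : ℕ} (A : Matrix (Fin n) (Fin n) ℝ) : Prop :=
  ∀ ξ : Space n, ξ ≠ 0 → 0 < inner ℝ (Matrix.toEuclideanLin A ξ) ξ

/-- The parameters and prescribed boundary data of one pore-network: porosity `φ`, permeability
`K`, the boundary parts `Γv`, `Γp` with the prescribed normal velocity `vn` and pressure `p₀`. -/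
structure Network (n : ℕ) where
  φ : Space n → ℝ
  K : Space n → Matrix (Fin n) (Fin n) ℝ
  Γv : Set (Space n)
  Γp : Set (Space n)
  vn : Space n → ℝ
  p₀ : Space n → ℝ

/-- The standing assumptions on one pore-network: positive porosity, positive definite
permeability, and a decomposition of the boundary into two disjoint parts. -/
structure Network.IsAdmissible {n : ℕ} (N : Network n) (Ω : Set (Space n)) : Prop where
  porosity_pos : ∀ x ∈ closure Ω, 0 < N.φ x
  permeability_pos : ∀ x ∈ Ω, IsPositiveDefinite (N.K x)
  boundary_union : N.Γv ∪ N.Γp = frontier Ω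
  boundary_disjoint : Disjoint N.Γv N.Γp

/-- The field `u = φ v` (discharge velocity) of a network. -/
def Network.discharge {n : ℕ} (N : Network n) (v : Space n → Space n) : Space n → Space n :=
  fun x => N.φ x • v x

/-- `(v, p)` solves, in the classical sense, the equations of one pore-network with viscosity
`μ`, true density `γ`, specific body force `b` and volumetric source `s`. -/
structure Network.IsClassicalFlow {n : ℕ} (N : Network n) (Ω : Set (Space n)) (μ γ : ℝ)
    (b : Space n → Space n) (s : Space n → ℝ) (v : Space n → Space n) (p : Space n → ℝ) :
    Prop where
  pressure_contDiff : ContDiffOn ℝ 1 p Ω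
  pressure_continuous : ContinuousOn p (closure Ω)
  discharge_contDiff : ContDiffOn ℝ 1 (N.discharge v) Ω
  discharge_continuous : ContinuousOn (N.discharge v) (closure Ω)
  /-- `μ φ² K⁻¹ v + φ grad p = ρ b` with the bulk density `ρ = φ γ` -/
  momentum : ∀ x ∈ Ω,
    (μ * N.φ x ^ 2) • Matrix.toEuclideanLin (N.K x)⁻¹ (v x) + N.φ x • gradient p x =
      (N.φ x * γ) • b x
  /-- `div (φ v) = s` -/
  mass_balance : ∀ x ∈ Ω, divergence (N.discharge v) x = s x
  /-- `v ⬝ n̂ = vn` on `Γv`, wherever the normal is defined -/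
  velocity_bc : ∀ x ∈ N.Γv, ∀ ν, IsOutwardUnitNormal Ω x ν → inner ℝ (v x) ν = N.vn x
  pressure_bc : ∀ x ∈ N.Γp, p x = N.p₀ x

/-- `(v₁, v₂, p₁, p₂, χ)` is a classical solution of the steady double porosity/permeability
model with macro-pore network `N₁` and micro-pore network `N₂`. -/
structure IsClassicalSolution {n : ℕ} (Ω : Set (Space n)) (N₁ N₂ : Network n) (μ β γ : ℝ)
    (b : Space n → Space n) (v₁ v₂ : Space n → Space n) (p₁ p₂ χ : Space n → ℝ) : Prop where
  flow₁ : N₁.IsClassicalFlow Ω μ γ b (fun x => χ x) v₁ p₁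
  flow₂ : N₂.IsClassicalFlow Ω μ γ b (fun x => -χ x) v₂ p₂
  mass_transfer : ∀ x ∈ Ω, χ x = -(β / μ) * (p₁ x - p₂ x)

end DoublePorosity

end

/-!
Let `q₁`, `q₂` and `u₁`, `u₂` be the differences of the pressures and of the discharge velocities
of two solutions. The energy flux `F = q₁ u₁ + q₂ u₂` has no normal component at regular boundary
points, and `div F = -(D₁ + D₂ + (β / μ) (q₁ - q₂)²)`, where the drag dissipations `D₁`, `D₂`
are nonnegative. Were the divergence theorem available, `∫ div F = 0` would force every term on the
right to vanish, so the velocities and the transfer agree and `q₁ = q₂` is constant.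

The fields are only continuous up to the boundary and `div F` need not be integrable, so the
divergence theorem is replaced by testing against `C¹` functions `ψ ≥ 0` with compact support.
Near a regular boundary point `Ω = {g < 0}`; cutting `ψ` off on the layer `{-δ < g < 0}`, of volume
`O(δ)`, produces an error of order `δ⁻¹ |F ⬝ ∇g|` on that layer, and `F ⬝ ∇g → 0` at the boundary.
This gives `∫_Ω ∇ψ ⬝ F ≥ 0` whenever `ψ` vanishes near the singular boundary. That set is compact
and `μH[n - 1]`-null, hence can be cut off by a function whose gradient has arbitrarily small `L¹`
norm.
-/

namespace DoublePorosity

section Divergence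

variable {n : ℕ} {Ω : Set (Space n)} {F G : Space n → Space n} {q : Space n → ℝ} {x : Space n}

theorem divergence_add (hF : DifferentiableAt ℝ F x) (hG : DifferentiableAt ℝ G x) :
    divergence (fun y => F y + G y) x = divergence F x + divergence G x := by
  simp [divergence, fderiv_fun_add hF hG, Finset.sum_add_distrib]

theorem divergence_sub (hF : DifferentiableAt ℝ F x) (hG : DifferentiableAt ℝ G x) :
    divergence (fun y => F y - G y) x = divergence F x - divergence G x := by
  simp [divergence, fderiv_fun_sub hF hG, Finset.sum_sub_distrib]

theorem divergence_smul (hq : DifferentiableAt ℝ q x) (hF : DifferentiableAt ℝ F x) :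
    divergence (fun y => q y • F y) x = q x * divergence F x + fderiv ℝ q x (F x) := by
  have h_coord : fderiv ℝ q x (F x) =
      ∑ j : Fin n, fderiv ℝ q x (EuclideanSpace.single j 1) * F x j := by
    conv_lhs => rw [← (EuclideanSpace.basisFun (Fin n) ℝ).sum_repr (F x)]
    simp [mul_comm]
  rw [h_coord]
  simp [divergence, fderiv_fun_smul hq hF, Finset.sum_add_distrib, Finset.mul_sum]

theorem divergence_congr (h : F =ᶠ[𝓝 x] G) : divergence F x = divergence G x := by
  simp only [divergence, h.fderiv_eq]

theorem continuousOn_divergence (hΩ : IsOpen Ω) (hF : ContDiffOn ℝ 1 F Ω) :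
    ContinuousOn (divergence F) Ω :=
  continuousOn_finsetSum _ fun j _ =>
    (EuclideanSpace.proj j : Space n →L[ℝ] ℝ).continuous.comp_continuousOn
      ((hF.continuousOn_fderiv_of_isOpen hΩ le_rfl).clm_apply continuousOn_const)

theorem integral_divergence_eq_zero (hG : ContDiff ℝ 1 G) (hc : HasCompactSupport G) :
    ∫ x, divergence G x = 0 := by
  let coord (j : Fin n) : Space n → ℝ := fun x => G x j
  have h_coord : ∀ j, ContDiff ℝ 1 (coord j) := fun j =>
    (EuclideanSpace.proj j : Space n →L[ℝ] ℝ).contDiff.comp hG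
  have h_supp : ∀ j, HasCompactSupport (coord j) := fun j =>
    hc.comp_left (g := fun v : Space n => v j) rfl
  have h_fderiv : ∀ j x v, (fderiv ℝ G x v) j = fderiv ℝ (coord j) x v := fun j x v =>
    (congrArg (fun T : Space n →L[ℝ] ℝ => T v)
      ((EuclideanSpace.proj j : Space n →L[ℝ] ℝ).hasFDerivAt.comp x
        (hG.differentiable one_ne_zero x).hasFDerivAt).fderiv).symm
  have h_int : ∀ j v, Integrable fun x => fderiv ℝ (coord j) x v := fun j v =>
    (((h_coord j).continuous_fderiv one_ne_zero).clm_apply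
      continuous_const).integrable_of_hasCompactSupport ((h_supp j).fderiv_apply (𝕜 := ℝ) v)
  have h_zero : ∀ j v, ∫ x, fderiv ℝ (coord j) x v = 0 := fun j v => by
    simpa using integral_mul_fderiv_eq_neg_fderiv_mul_of_integrable (μ := volume)
      (f := fun _ => (1 : ℝ)) (g := coord j) (v := v) (by simp) (by simpa using h_int j v)
      (by simpa using (h_coord j).continuous.integrable_of_hasCompactSupport (h_supp j))
      (fun _ _ => differentiableAt_const _)
      (fun x _ => (h_coord j).differentiable one_ne_zero x)
  simp only [divergence, h_fderiv]
  rw [integral_finsetSum _ fun j _ => h_int j _]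
  exact Finset.sum_eq_zero fun j _ => h_zero j _

end Divergence

section FluxPairing

/-- The pairing `∫_Ω ∇ψ ⬝ F` of a test function `ψ` with the distribution `-div (1_Ω F)`. On test
functions vanishing at `∂Ω` it is `-∫ ψ div F`; in general it also sees the flux of `F` through
`∂Ω`. -/
noncomputable def fluxPairing {n : ℕ} (Ω : Set (Space n)) (F : Space n → Space n)
    (ψ : Space n → ℝ) : ℝ :=
  ∫ x in Ω, fderiv ℝ ψ x (F x)

variable {n : ℕ} {Ω : Set (Space n)} {F : Space n → Space n} {ψ ζ : Space n → ℝ}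

theorem integrableOn_fderiv_apply (hb : Bornology.IsBounded Ω) (hF : ContinuousOn F (closure Ω))
    (hψ : ContDiff ℝ 1 ψ) : IntegrableOn (fun x => fderiv ℝ ψ x (F x)) Ω :=
  (((hψ.continuous_fderiv one_ne_zero).continuousOn.clm_apply hF).integrableOn_compact
    hb.isCompact_closure).mono_set subset_closure

theorem fluxPairing_congr (hΩ : IsOpen Ω) (h : EqOn ψ ζ Ω) :
    fluxPairing Ω F ψ = fluxPairing Ω F ζ :=
  setIntegral_congr_fun hΩ.measurableSet fun x hx => by
    simp only [(h.eventuallyEq_of_mem (hΩ.mem_nhds hx)).fderiv_eq]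

theorem fluxPairing_sub (hb : Bornology.IsBounded Ω) (hF : ContinuousOn F (closure Ω))
    (hψ : ContDiff ℝ 1 ψ) (hζ : ContDiff ℝ 1 ζ) :
    fluxPairing Ω F (fun x => ψ x - ζ x) = fluxPairing Ω F ψ - fluxPairing Ω F ζ := by
  rw [fluxPairing, fluxPairing, fluxPairing, ← integral_sub (integrableOn_fderiv_apply hb hF hψ)
    (integrableOn_fderiv_apply hb hF hζ)]
  congr with x
  rw [fderiv_fun_sub (hψ.differentiable one_ne_zero x) (hζ.differentiable one_ne_zero x),
    sub_apply]

theorem abs_fluxPairing_sub_le {L : Set (Space n)} {B : ℝ} (hΩ : MeasurableSet Ω)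
    (hb : Bornology.IsBounded Ω) (hF : ContinuousOn F (closure Ω)) (hψ : ContDiff ℝ 1 ψ)
    (hζ : ContDiff ℝ 1 ζ) (hLΩ : L ⊆ Ω)
    (h_zero : ∀ x ∈ Ω \ L, fderiv ℝ ψ x (F x) - fderiv ℝ ζ x (F x) = 0)
    (h_le : ∀ x ∈ L, |fderiv ℝ ψ x (F x) - fderiv ℝ ζ x (F x)| ≤ B) :
    |fluxPairing Ω F ψ - fluxPairing Ω F ζ| ≤ B * volume.real L := by
  rw [fluxPairing, fluxPairing, ← integral_sub (integrableOn_fderiv_apply hb hF hψ)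
    (integrableOn_fderiv_apply hb hF hζ),
    setIntegral_eq_of_subset_of_forall_sdiff_eq_zero hΩ hLΩ h_zero]
  exact norm_setIntegral_le_of_norm_le_const
    (f := fun x => fderiv ℝ ψ x (F x) - fderiv ℝ ζ x (F x)) (hb.subset hLΩ).measure_lt_top h_le

theorem fluxPairing_finsetSum {ι : Type*} {t : Finset ι} {ψ : ι → Space n → ℝ}
    (hb : Bornology.IsBounded Ω) (hF : ContinuousOn F (closure Ω))
    (hψ : ∀ i ∈ t, ContDiff ℝ 1 (ψ i)) :
    fluxPairing Ω F (fun x => ∑ i ∈ t, ψ i x) = ∑ i ∈ t, fluxPairing Ω F (ψ i) := by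
  simp only [fluxPairing]
  rw [← integral_finsetSum _ fun i hi => integrableOn_fderiv_apply hb hF (hψ i hi)]
  congr with x
  rw [fderiv_fun_sum fun i hi => (hψ i hi).differentiable one_ne_zero x,
    sum_apply]

theorem enorm_fluxPairing_le {M : ℝ} (hΩ : MeasurableSet Ω) (hM : ∀ x ∈ Ω, ‖F x‖ ≤ M) :
    ‖fluxPairing Ω F ψ‖ₑ ≤ (∫⁻ x, ‖fderiv ℝ ψ x‖ₑ) * ENNReal.ofReal M :=
  calc ‖fluxPairing Ω F ψ‖ₑ ≤ ∫⁻ x in Ω, ‖fderiv ℝ ψ x (F x)‖ₑ :=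
        enorm_integral_le_lintegral_enorm _
    _ ≤ ∫⁻ x in Ω, ‖fderiv ℝ ψ x‖ₑ * ENNReal.ofReal M := by
        refine setLIntegral_mono' hΩ fun x hx => ContinuousLinearMap.le_opENorm_of_le _ ?_
        rw [← ofReal_norm]
        exact ENNReal.ofReal_le_ofReal (hM x hx)
    _ ≤ ∫⁻ x, ‖fderiv ℝ ψ x‖ₑ * ENNReal.ofReal M := setLIntegral_le_lintegral _ _
    _ = (∫⁻ x, ‖fderiv ℝ ψ x‖ₑ) * ENNReal.ofReal M :=
        lintegral_mul_const' _ _ ENNReal.ofReal_ne_top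

theorem continuous_mul_neg_divergence (hΩ : IsOpen Ω) (hF : ContDiffOn ℝ 1 F Ω)
    (hζ : Continuous ζ) (hs : tsupport ζ ⊆ Ω) : Continuous fun x => ζ x * -divergence F x :=
  (hζ.continuousOn.mul (continuousOn_divergence hΩ hF).neg).continuous_of_tsupport_subset hΩ
    (tsupport_mul_subset_left.trans hs)

theorem mul_neg_divergence_nonneg (hdiv : ∀ x ∈ Ω, divergence F x ≤ 0) (hζ0 : 0 ≤ ζ)
    (hs : tsupport ζ ⊆ Ω) : 0 ≤ fun x => ζ x * -divergence F x := fun x => by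
  by_cases hx : x ∈ tsupport ζ
  · exact mul_nonneg (hζ0 x) (neg_nonneg.2 (hdiv x (hs hx)))
  · simp [image_eq_zero_of_notMem_tsupport hx]

theorem fluxPairing_eq_integral_mul_neg_divergence (hΩ : IsOpen Ω) (hF : ContDiffOn ℝ 1 F Ω)
    (hζ : ContDiff ℝ 1 ζ) (hc : HasCompactSupport ζ) (hs : tsupport ζ ⊆ Ω) :
    fluxPairing Ω F ζ = ∫ x, ζ x * -divergence F x := by
  have hF_diff : ∀ x ∈ Ω, DifferentiableAt ℝ F x := fun x hx =>
    (hF.differentiableOn one_ne_zero).differentiableAt (hΩ.mem_nhds hx)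
  have hζF : ContDiff ℝ 1 fun x => ζ x • F x := by
    rw [← contMDiff_iff_contDiff]
    refine contMDiff_of_tsupport fun x hx => contMDiffAt_iff_contDiffAt.2 ?_
    exact hζ.contDiffAt.smul
      (hF.contDiffAt (hΩ.mem_nhds (hs (tsupport_smul_subset_left ζ F hx))))
  have h_div : ∀ x, divergence (fun y => ζ y • F y) x =
      fderiv ℝ ζ x (F x) - ζ x * -divergence F x := by
    intro x
    by_cases hx : x ∈ tsupport ζ
    · rw [divergence_smul (hζ.differentiable one_ne_zero x) (hF_diff x (hs hx))]
      ring
    · have hζ0 : ζ =ᶠ[𝓝 x] fun _ => 0 := notMem_tsupport_iff_eventuallyEq.1 hx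
      have hζF0 : (fun y => ζ y • F y) =ᶠ[𝓝 x] fun _ => 0 := hζ0.mono fun y hy => by simp [hy]
      rw [divergence_congr hζF0, hζ0.fderiv_eq, hζ0.eq_of_nhds]
      simp [divergence]
  have h_support : Function.support (fun x => fderiv ℝ ζ x (F x)) ⊆ tsupport ζ := fun x hx =>
    support_fderiv_subset ℝ fun h0 => hx (by simp [h0])
  have h_int : Integrable fun x => ζ x * -divergence F x :=
    (continuous_mul_neg_divergence hΩ hF hζ.continuous hs).integrable_of_hasCompactSupport
      hc.mul_right
  have h_int' : Integrable fun x => fderiv ℝ ζ x (F x) :=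
    (((hζ.continuous_fderiv one_ne_zero).continuousOn.clm_apply
      hF.continuousOn).continuous_of_tsupport_subset hΩ
        ((closure_minimal h_support (isClosed_tsupport ζ)).trans hs)
      ).integrable_of_hasCompactSupport (hc.mono' h_support)
  have h_zero := integral_divergence_eq_zero hζF hc.smul_right
  simp only [h_div] at h_zero
  rw [integral_sub h_int' h_int, sub_eq_zero] at h_zero
  rw [← h_zero]
  refine setIntegral_eq_integral_of_forall_compl_eq_zero fun x hx => ?_
  exact Function.notMem_support.1 fun hx' => hx (hs (h_support hx'))

theorem fluxPairing_nonneg_of_tsupport_subset (hΩ : IsOpen Ω) (hF : ContDiffOn ℝ 1 F Ω)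
    (hdiv : ∀ x ∈ Ω, divergence F x ≤ 0) (hζ : ContDiff ℝ 1 ζ) (hζ0 : 0 ≤ ζ)
    (hc : HasCompactSupport ζ) (hs : tsupport ζ ⊆ Ω) : 0 ≤ fluxPairing Ω F ζ := by
  rw [fluxPairing_eq_integral_mul_neg_divergence hΩ hF hζ hc hs]
  exact integral_nonneg (mul_neg_divergence_nonneg hdiv hζ0 hs)

theorem fluxPairing_pos_of_tsupport_subset (hΩ : IsOpen Ω) (hF : ContDiffOn ℝ 1 F Ω)
    (hdiv : ∀ x ∈ Ω, divergence F x ≤ 0) (hζ : ContDiff ℝ 1 ζ) (hζ0 : 0 ≤ ζ)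
    (hc : HasCompactSupport ζ) (hs : tsupport ζ ⊆ Ω) {x₀ : Space n} (hζx₀ : ζ x₀ ≠ 0)
    (hx₀ : divergence F x₀ ≠ 0) : 0 < fluxPairing Ω F ζ := by
  rw [fluxPairing_eq_integral_mul_neg_divergence hΩ hF hζ hc hs]
  exact (continuous_mul_neg_divergence hΩ hF hζ.continuous hs
    ).integral_pos_of_hasCompactSupport_nonneg_nonzero hc.mul_right
    (mul_neg_divergence_nonneg hdiv hζ0 hs) (mul_ne_zero hζx₀ (neg_ne_zero.2 hx₀))

end FluxPairing

section Layers

variable {E : Type*} [NormedAddCommGroup E] [NormedSpace ℝ E]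

theorem add_mul_le_of_le_fderiv {U : Set E} (hU : Convex ℝ U) {g : E → ℝ} {e : E} {c : ℝ}
    (hg : ∀ y ∈ U, DifferentiableAt ℝ g y) (hc : ∀ y ∈ U, c ≤ fderiv ℝ g y e) {y : E} {t : ℝ}
    (ht : 0 ≤ t) (hy : y ∈ U) (hyt : y + t • e ∈ U) : g y + c * t ≤ g (y + t • e) := by
  have h_mem : ∀ s ∈ Icc 0 t, y + s • e ∈ U := fun s hs =>
    ((hU.translate_preimage_right y).is_linear_preimage
      (IsLinearMap.isLinearMap_smul' e)).ordConnected.out (x := 0) (by simpa using hy) hyt hs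
  have h_deriv : ∀ s ∈ Icc 0 t,
      HasDerivAt (fun s : ℝ => g (y + s • e)) (fderiv ℝ g (y + s • e) e) s := fun s hs =>
    (hg _ (h_mem s hs)).hasFDerivAt.comp_hasDerivAt s <| by
      simpa using ((hasDerivAt_id s).smul_const e).const_add y
  have h_mvt := (convex_Icc 0 t).mul_sub_le_image_sub_of_le_deriv
    (fun s hs => (h_deriv s hs).continuousAt.continuousWithinAt)
    (fun s hs => (h_deriv s (interior_subset hs)).differentiableAt.differentiableWithinAt)
    (fun s hs => (hc _ (h_mem s (interior_subset hs))).trans_eq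
      (h_deriv s (interior_subset hs)).deriv.symm)
    0 (left_mem_Icc.2 ht) t (right_mem_Icc.2 ht) ht
  simp only [sub_zero, zero_smul, add_zero] at h_mvt
  linarith

theorem volume_setOf_smul_add_mem_le {S : Set E} {x e y : E} {r d : ℝ}
    (hSr : S ⊆ Metric.ball x r) (hd : ∀ z ∈ S, ∀ t ≥ 0, z + t • e ∈ S → t ≤ d) :
    volume {t | t ∈ Ioo (0 : ℝ) 1 ∧ t • e + y ∈ S} ≤
      (Metric.ball x (r + ‖e‖)).indicator (fun _ => ENNReal.ofReal d) y := by
  by_cases hy : y ∈ Metric.ball x (r + ‖e‖)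
  · rw [indicator_of_mem hy]
    refine (Real.volume_le_diam _).trans (Metric.ediam_le fun s hs t ht => ?_)
    rw [edist_dist]
    refine ENNReal.ofReal_le_ofReal ?_
    wlog hst : s ≤ t generalizing s t
    · rw [dist_comm]
      exact this t ht s hs (le_of_not_ge hst)
    rw [dist_comm, Real.dist_eq, abs_of_nonneg (sub_nonneg.2 hst)]
    refine hd _ hs.2 _ (sub_nonneg.2 hst) ?_
    convert ht.2 using 1
    module
  · suffices {t | t ∈ Ioo (0 : ℝ) 1 ∧ t • e + y ∈ S} = ∅ by simp only [this, measure_empty, zero_le]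
    refine eq_empty_of_forall_notMem fun t ht => hy ?_
    calc dist y x ≤ dist y (t • e + y) + dist (t • e + y) x := dist_triangle _ _ _
      _ < ‖e‖ + r := by
        refine add_lt_add_of_le_of_lt ?_ (hSr ht.2)
        rw [dist_add_self_right, norm_smul, Real.norm_of_nonneg ht.1.1.le]
        exact mul_le_of_le_one_left (norm_nonneg e) ht.1.2.le
      _ = r + ‖e‖ := add_comm _ _

-- Fubini for the set of all `(t, y)` with `y + t • e ∈ S` and `0 < t < 1`.
theorem measure_le_of_forall_add_smul_mem [MeasurableSpace E] [BorelSpace E] (ν : Measure E)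
    [ν.IsAddLeftInvariant] [SFinite ν] {S : Set E} (hS : MeasurableSet S) {x e : E} {r d : ℝ}
    (hSr : S ⊆ Metric.ball x r) (hd : ∀ y ∈ S, ∀ t ≥ 0, y + t • e ∈ S → t ≤ d) :
    ν S ≤ ENNReal.ofReal d * ν (Metric.ball x (r + ‖e‖)) := by
  let Z : Set (ℝ × E) := {z | z.1 ∈ Ioo 0 1 ∧ z.1 • e + z.2 ∈ S}
  have hZ : MeasurableSet Z := by
    refine (measurable_fst measurableSet_Ioo).inter (Continuous.measurable ?_ hS)
    fun_prop
  have h_slice : ∀ t, ν (Prod.mk t ⁻¹' Z) = (Ioo (0 : ℝ) 1).indicator (fun _ => ν S) t := by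
    intro t
    by_cases ht : t ∈ Ioo (0 : ℝ) 1
    · rw [indicator_of_mem ht, ← measure_preimage_add ν (t • e) S]
      congr 1
      ext y
      simp [Z, ht.1, ht.2]
    · rw [indicator_of_notMem ht, show Prod.mk t ⁻¹' Z = ∅ from
        eq_empty_of_forall_notMem fun y hy => ht hy.1, measure_empty]
  calc ν S = ∫⁻ t, ν (Prod.mk t ⁻¹' Z) := by
        simp [h_slice, lintegral_indicator_const measurableSet_Ioo]
    _ = ∫⁻ y, volume ((fun t => (t, y)) ⁻¹' Z) ∂ν := by
        rw [← Measure.prod_apply hZ, Measure.prod_apply_symm hZ]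
    _ ≤ ∫⁻ y, (Metric.ball x (r + ‖e‖)).indicator (fun _ => ENNReal.ofReal d) y ∂ν :=
        lintegral_mono fun y => volume_setOf_smul_add_mem_le hSr hd
    _ = ENNReal.ofReal d * ν (Metric.ball x (r + ‖e‖)) :=
        lintegral_indicator_const Metric.isOpen_ball.measurableSet _

theorem exists_measureReal_ball_inter_preimage_Ioo_le [FiniteDimensional ℝ E] [MeasurableSpace E]
    [BorelSpace E] (ν : Measure E) [ν.IsAddHaarMeasure] {g : E → ℝ} {x : E}
    (hg : ContDiffAt ℝ 1 g x) (hgx : fderiv ℝ g x ≠ 0) :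
    ∃ r > 0, ∃ κ, ∀ a b, a ≤ b → ν.real (Metric.ball x r ∩ g ⁻¹' Ioo a b) ≤ κ * (b - a) := by
  obtain ⟨e, he⟩ : ∃ e, 1 < fderiv ℝ g x e := by
    obtain ⟨e, he⟩ := DFunLike.ne_iff.1 hgx
    exact ⟨(2 / fderiv ℝ g x e) • e, by simp [div_mul_cancel₀ _ he]⟩
  obtain ⟨r, hr, h_ball⟩ := Metric.eventually_nhds_iff_ball.1
    ((hg.eventually (by simp)).and
      ((hg.continuousAt_fderiv one_ne_zero).clm_apply continuousAt_const |>.eventually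
        (lt_mem_nhds he)))
  have h_diff : ∀ y ∈ Metric.ball x r, DifferentiableAt ℝ g y := fun y hy =>
    (h_ball y hy).1.differentiableAt one_ne_zero
  refine ⟨r, hr, ν.real (Metric.ball x (r + ‖e‖)), fun a b hab => ?_⟩
  have h_open : IsOpen (Metric.ball x r ∩ g ⁻¹' Ioo a b) :=
    ContinuousOn.isOpen_inter_preimage
      (fun y hy => (h_diff y hy).continuousAt.continuousWithinAt) Metric.isOpen_ball isOpen_Ioo
  have h_le := measure_le_of_forall_add_smul_mem ν (e := e) (d := b - a) h_open.measurableSet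
    inter_subset_left fun y hy t ht hyt => by
      have h_growth := add_mul_le_of_le_fderiv (convex_ball x r) h_diff
        (fun z hz => (h_ball z hz).2.le) ht hy.1 hyt.1
      linarith [hy.2.1, hyt.2.2]
  have := ENNReal.toReal_mono
    (ENNReal.mul_ne_top ENNReal.ofReal_ne_top measure_ball_lt_top.ne) h_le
  rwa [ENNReal.toReal_mul, ENNReal.toReal_ofReal (sub_nonneg.2 hab), mul_comm] at this

end Layers

section DefiningFunction

/-- The edges and corners of `Ω`: the boundary points at which `∂Ω` is not a `C¹` hypersurface with
`Ω` on one side. -/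
def singularBoundary {n : ℕ} (Ω : Set (Space n)) : Set (Space n) :=
  {x ∈ frontier Ω | ¬ ∃ ν, IsOutwardUnitNormal Ω x ν}

/-- `g` is a `C¹` function without critical points on `U` such that `Ω ∩ U = {g < 0} ∩ U`. -/
structure IsLocalDefiningFunction {n : ℕ} (Ω U : Set (Space n)) (g : Space n → ℝ) : Prop where
  contDiffAt : ∀ y ∈ U, ContDiffAt ℝ 1 g y
  gradient_ne_zero : ∀ y ∈ U, gradient g y ≠ 0
  mem_iff : ∀ y ∈ U, y ∈ Ω ↔ g y < 0

variable {n : ℕ} {Ω U : Set (Space n)} {g : Space n → ℝ} {x : Space n}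

namespace IsLocalDefiningFunction

theorem mono {V : Set (Space n)} (hg : IsLocalDefiningFunction Ω U g) (hVU : V ⊆ U) :
    IsLocalDefiningFunction Ω V g where
  contDiffAt y hy := hg.contDiffAt y (hVU hy)
  gradient_ne_zero y hy := hg.gradient_ne_zero y (hVU hy)
  mem_iff y hy := hg.mem_iff y (hVU hy)

theorem continuousOn (hg : IsLocalDefiningFunction Ω U g) : ContinuousOn g U := fun y hy =>
  (hg.contDiffAt y hy).continuousAt.continuousWithinAt

theorem continuousOn_fderiv (hg : IsLocalDefiningFunction Ω U g) : ContinuousOn (fderiv ℝ g) U :=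
  fun y hy => ((hg.contDiffAt y hy).continuousAt_fderiv one_ne_zero).continuousWithinAt

theorem isOutwardUnitNormal (hg : IsLocalDefiningFunction Ω U g) (hU : U ∈ 𝓝 x)
    (hx : x ∈ frontier Ω) :
    IsOutwardUnitNormal Ω x (‖gradient g x‖⁻¹ • gradient g x) :=
  ⟨hx, g, hg.contDiffAt x (mem_of_mem_nhds hU), hg.gradient_ne_zero x (mem_of_mem_nhds hU),
    mem_of_superset hU hg.mem_iff, rfl⟩

theorem mem_frontier (hg : IsLocalDefiningFunction Ω U g) (hΩ : IsOpen Ω) (hxU : x ∈ U)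
    (hx : x ∈ closure Ω) (hgx : g x = 0) : x ∈ frontier Ω :=
  ⟨hx, fun hxΩ => ((hg.mem_iff x hxU).1 (hΩ.interior_eq ▸ hxΩ)).ne hgx⟩

theorem fderiv_apply_eq_zero {F : Space n → Space n} (hg : IsLocalDefiningFunction Ω U g)
    (hΩ : IsOpen Ω) (hflux : ∀ y ν, IsOutwardUnitNormal Ω y ν → inner ℝ (F y) ν = 0)
    (hU : U ∈ 𝓝 x) (hx : x ∈ closure Ω) (hgx : g x = 0) : fderiv ℝ g x (F x) = 0 := by
  have hxU := mem_of_mem_nhds hU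
  have h_normal := hflux x _ (hg.isOutwardUnitNormal hU (hg.mem_frontier hΩ hxU hx hgx))
  rw [inner_smul_right, real_inner_comm, inner_gradient_left] at h_normal
  exact (mul_eq_zero.1 h_normal).resolve_left
    (inv_ne_zero (norm_ne_zero_iff.2 (hg.gradient_ne_zero x hxU)))

end IsLocalDefiningFunction

theorem IsOutwardUnitNormal.exists_isLocalDefiningFunction {ν : Space n}
    (h : IsOutwardUnitNormal Ω x ν) :
    ∃ U ∈ 𝓝 x, ∃ g, IsLocalDefiningFunction Ω U g := by
  obtain ⟨-, g, hg, hgx, h_mem, -⟩ := h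
  have h_contDiff : ∀ᶠ y in 𝓝 x, ContDiffAt ℝ 1 g y := hg.eventually (by simp)
  have h_grad : ∀ᶠ y in 𝓝 x, gradient g y ≠ 0 :=
    ((InnerProductSpace.toDual ℝ (Space n)).symm.continuous.continuousAt.comp
      (hg.continuousAt_fderiv one_ne_zero)).eventually_ne hgx
  exact ⟨{y | ContDiffAt ℝ 1 g y ∧ gradient g y ≠ 0 ∧ (y ∈ Ω ↔ g y < 0)},
    h_contDiff.and (h_grad.and h_mem), g,
    fun y hy => hy.1, fun y hy => hy.2.1, fun y hy => hy.2.2⟩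

theorem isClosed_singularBoundary : IsClosed (singularBoundary Ω) := by
  have h_open : IsOpen {x | ∃ U ∈ 𝓝 x, ∃ g, IsLocalDefiningFunction Ω U g} :=
    isOpen_iff_mem_nhds.2 fun x ⟨U, hU, g, hg⟩ =>
      (eventually_mem_nhds_iff.2 hU).mono fun y hy => ⟨U, hy, g, hg⟩
  suffices singularBoundary Ω =
      frontier Ω \ {x | ∃ U ∈ 𝓝 x, ∃ g, IsLocalDefiningFunction Ω U g} from
    this ▸ isClosed_frontier.sdiff h_open
  ext x
  refine and_congr_right fun hx => not_congr ⟨?_, ?_⟩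
  · rintro ⟨ν, hν⟩
    exact hν.exists_isLocalDefiningFunction
  · rintro ⟨U, hU, g, hg⟩
    exact ⟨_, hg.isOutwardUnitNormal hU hx⟩

theorem mem_or_exists_isOutwardUnitNormal (hΩ : IsOpen Ω) (hx : x ∈ closure Ω)
    (hxs : x ∉ singularBoundary Ω) : x ∈ Ω ∨ ∃ ν, IsOutwardUnitNormal Ω x ν := by
  by_cases hxΩ : x ∈ Ω
  · exact Or.inl hxΩ
  · exact Or.inr (not_not.1 fun h => hxs ⟨⟨hx, hΩ.interior_eq.symm ▸ hxΩ⟩, h⟩)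

end DefiningFunction

section InnerCutoff

theorem exists_abs_lt_of_eq_zero_imp {X : Type*} [TopologicalSpace X] [T2Space X] {K : Set X}
    (hK : IsCompact K) {a g : X → ℝ} (ha : ContinuousOn a K) (hg : ContinuousOn g K)
    (h : ∀ y ∈ K, g y = 0 → a y = 0) {ε : ℝ} (hε : 0 < ε) :
    ∃ δ > 0, ∀ y ∈ K, |g y| < δ → |a y| < ε := by
  have hc : IsCompact (K ∩ (fun y => |a y|) ⁻¹' Ici ε) :=
    hK.of_isClosed_subset (ha.abs.preimage_isClosed_of_isClosed hK.isClosed isClosed_Ici)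
      inter_subset_left
  obtain ⟨δ, hδ, h_le⟩ := hc.exists_forall_le' (hg.abs.mono inter_subset_left) (a := 0)
    fun y hy => abs_pos.2 fun hgy => by
      have hay : ε ≤ |a y| := hy.2
      rw [h y hy.1 hgy, abs_zero] at hay
      exact hay.not_gt hε
  exact ⟨δ, hδ, fun y hy hgy => not_le.1 fun hay => (h_le y ⟨hy, hay⟩).not_gt hgy⟩

theorem exists_abs_deriv_smoothTransition_le :
    ∃ C : ℝ, ∀ t, |deriv Real.smoothTransition t| ≤ C := by
  refine HasCompactSupport.exists_bound_of_continuous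
    (HasCompactSupport.intro (isCompact_Icc (a := (0 : ℝ)) (b := 1)) fun t ht => ?_)
    ((Real.smoothTransition.contDiff (n := 1)).continuous_deriv le_rfl)
  rcases lt_or_ge t 0 with ht0 | ht0
  · have h_eq : Real.smoothTransition =ᶠ[𝓝 t] fun _ => 0 :=
      (gt_mem_nhds ht0).mono fun s hs => Real.smoothTransition.zero_of_nonpos hs.le
    rw [h_eq.deriv_eq, deriv_const]
  · have h_eq : Real.smoothTransition =ᶠ[𝓝 t] fun _ => 1 :=
      (lt_mem_nhds (not_le.1 fun ht1 => ht ⟨ht0, ht1⟩)).mono fun s hs =>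
        Real.smoothTransition.one_of_one_le (le_of_lt hs)
    rw [h_eq.deriv_eq, deriv_const]

/-- The test function `ψ` cut off smoothly near the zero set of `g`: it is `ψ` where `g ≤ -2δ` and
`0` where `-δ ≤ g`. -/
noncomputable def innerCutoff {E : Type*} (ψ g : E → ℝ) (δ : ℝ) (y : E) : ℝ :=
  ψ y * Real.smoothTransition (-(g y) / δ - 1)

theorem innerCutoff_eq_zero {E : Type*} {ψ g : E → ℝ} {δ : ℝ} {y : E} (hδ : 0 < δ)
    (hy : -δ ≤ g y) : innerCutoff ψ g δ y = 0 := by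
  have h_le : -(g y) / δ ≤ 1 := (div_le_one hδ).2 (by linarith)
  rw [innerCutoff, Real.smoothTransition.zero_of_nonpos (sub_nonpos.2 h_le), mul_zero]

theorem innerCutoff_eq_self {E : Type*} {ψ g : E → ℝ} {δ : ℝ} {y : E} (hδ : 0 < δ)
    (hy : g y ≤ -(2 * δ)) : innerCutoff ψ g δ y = ψ y := by
  have h_le : 2 ≤ -(g y) / δ := (le_div_iff₀ hδ).2 (by linarith)
  rw [innerCutoff, Real.smoothTransition.one_of_one_le (by linarith), mul_one]

theorem innerCutoff_nonneg {E : Type*} {ψ g : E → ℝ} (δ : ℝ) (hψ : 0 ≤ ψ) :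
    0 ≤ innerCutoff ψ g δ := fun y =>
  mul_nonneg (hψ y) (Real.smoothTransition.nonneg _)

theorem tsupport_innerCutoff_subset_tsupport {E : Type*} [TopologicalSpace E] {ψ g : E → ℝ}
    {δ : ℝ} : tsupport (innerCutoff ψ g δ) ⊆ tsupport ψ :=
  tsupport_mul_subset_left

variable {n : ℕ} {Ω U : Set (Space n)} {ψ g : Space n → ℝ} {δ : ℝ}

namespace IsLocalDefiningFunction

theorem tsupport_innerCutoff_subset (hg : IsLocalDefiningFunction Ω U g) (hδ : 0 < δ)
    (hU : IsOpen U) (hψU : tsupport ψ ⊆ U) : tsupport (innerCutoff ψ g δ) ⊆ Ω := by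
  intro y hy
  have hyU : y ∈ U := hψU (tsupport_innerCutoff_subset_tsupport hy)
  refine (hg.mem_iff y hyU).2 (lt_of_le_of_lt (not_lt.1 fun hgy => ?_) (neg_lt_zero.2 hδ))
  refine notMem_tsupport_iff_eventuallyEq.2 ?_ hy
  exact ((hg.continuousOn.continuousAt (hU.mem_nhds hyU)).eventually (lt_mem_nhds hgy)).mono
    fun z hz => innerCutoff_eq_zero hδ hz.le

theorem contDiff_innerCutoff (hg : IsLocalDefiningFunction Ω U g) (hψ : ContDiff ℝ 1 ψ)
    (hψU : tsupport ψ ⊆ U) : ContDiff ℝ 1 (innerCutoff ψ g δ) := by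
  rw [← contMDiff_iff_contDiff]
  refine contMDiff_of_tsupport fun y hy => contMDiffAt_iff_contDiffAt.2 ?_
  have hgy := hg.contDiffAt y (hψU (tsupport_innerCutoff_subset_tsupport hy))
  exact hψ.contDiffAt.mul (Real.smoothTransition.contDiffAt.comp y
    ((hgy.neg.div_const δ).sub contDiffAt_const))

theorem fderiv_innerCutoff (hg : IsLocalDefiningFunction Ω U g) (hψ : ContDiff ℝ 1 ψ)
    {y : Space n} (hy : y ∈ U) (v : Space n) :
    fderiv ℝ (innerCutoff ψ g δ) y v =
      Real.smoothTransition (-(g y) / δ - 1) * fderiv ℝ ψ y v -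
        deriv Real.smoothTransition (-(g y) / δ - 1) / δ * (ψ y * fderiv ℝ g y v) := by
  have h_inner : HasFDerivAt (fun z => -(g z) / δ - 1) (-(δ⁻¹ • fderiv ℝ g y)) y := by
    simpa [div_eq_inv_mul] using ((((hg.contDiffAt y hy).differentiableAt
      one_ne_zero).hasFDerivAt.neg.const_mul δ⁻¹).sub_const 1)
  have h_transition := ((Real.smoothTransition.contDiff (n := 1)).differentiable one_ne_zero
    (-(g y) / δ - 1)).hasDerivAt.comp_hasFDerivAt y h_inner
  have h_mul := (hψ.differentiable one_ne_zero y).hasFDerivAt.mul h_transition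
  rw [show innerCutoff ψ g δ = ψ * (Real.smoothTransition ∘ fun z => -(g z) / δ - 1) from rfl,
    h_mul.fderiv]
  simp only [smul_neg, Function.comp_apply, add_apply, neg_apply, smul_apply, smul_eq_mul]
  ring

theorem abs_fderiv_sub_fderiv_innerCutoff_le (hg : IsLocalDefiningFunction Ω U g)
    (hψ : ContDiff ℝ 1 ψ) (hδ : 0 < δ) {C : ℝ} (hC : ∀ t, |deriv Real.smoothTransition t| ≤ C)
    {y : Space n} (hy : y ∈ U) (v : Space n) :
    |fderiv ℝ ψ y v - fderiv ℝ (innerCutoff ψ g δ) y v| ≤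
      |fderiv ℝ ψ y v| + C / δ * |ψ y * fderiv ℝ g y v| := by
  set s := -(g y) / δ - 1
  have hs : |1 - Real.smoothTransition s| ≤ 1 := by
    rw [abs_le]
    constructor <;> linarith [Real.smoothTransition.nonneg s, Real.smoothTransition.le_one s]
  calc |fderiv ℝ ψ y v - fderiv ℝ (innerCutoff ψ g δ) y v|
      = |(1 - Real.smoothTransition s) * fderiv ℝ ψ y v +
          deriv Real.smoothTransition s / δ * (ψ y * fderiv ℝ g y v)| := by
        have h_fderiv : fderiv ℝ (innerCutoff ψ g δ) y v =
            Real.smoothTransition s * _ - deriv Real.smoothTransition s / δ * _ :=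
          hg.fderiv_innerCutoff hψ hy v
        rw [h_fderiv]
        ring_nf
    _ ≤ |1 - Real.smoothTransition s| * |fderiv ℝ ψ y v| +
          |deriv Real.smoothTransition s| / δ * |ψ y * fderiv ℝ g y v| := by
        refine (abs_add_le _ _).trans_eq ?_
        rw [abs_mul, abs_mul, abs_div, abs_of_pos hδ]
    _ ≤ |fderiv ℝ ψ y v| + C / δ * |ψ y * fderiv ℝ g y v| := by
        gcongr
        · exact mul_le_of_le_one_left (abs_nonneg _) hs
        · exact hC s

theorem fderiv_sub_fderiv_innerCutoff_eq_zero (hg : IsLocalDefiningFunction Ω U g)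
    (hU : IsOpen U) (hδ : 0 < δ) (hψU : tsupport ψ ⊆ U) {y : Space n}
    (hy : y ∈ Ω \ (tsupport ψ ∩ g ⁻¹' Ioo (-(3 * δ)) 0)) (v : Space n) :
    fderiv ℝ ψ y v - fderiv ℝ (innerCutoff ψ g δ) y v = 0 := by
  by_cases hyψ : y ∈ tsupport ψ
  · have hgy : g y ≤ -(3 * δ) := not_lt.1 fun hgy =>
      hy.2 ⟨hyψ, hgy, (hg.mem_iff y (hψU hyψ)).1 hy.1⟩
    have h_near : innerCutoff ψ g δ =ᶠ[𝓝 y] ψ :=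
      ((hg.continuousOn.continuousAt (hU.mem_nhds (hψU hyψ))).eventually
        (gt_mem_nhds (show g y < -(2 * δ) by linarith))).mono
          fun z hz => innerCutoff_eq_self hδ (le_of_lt hz)
    rw [h_near.fderiv_eq, sub_self]
  · rw [fderiv_of_notMem_tsupport ℝ hyψ, fderiv_of_notMem_tsupport ℝ fun hy' =>
      hyψ (tsupport_innerCutoff_subset_tsupport hy'), sub_self]

end IsLocalDefiningFunction

variable {F : Space n → Space n}

theorem abs_fluxPairing_sub_innerCutoff_le (hg : IsLocalDefiningFunction Ω U g) (hU : IsOpen U)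
    (hΩ : IsOpen Ω) (hb : Bornology.IsBounded Ω) (hF : ContinuousOn F (closure Ω))
    (hψ : ContDiff ℝ 1 ψ) (hψU : tsupport ψ ⊆ U) (hδ : 0 < δ) {C M ε : ℝ}
    (hC : ∀ t, |deriv Real.smoothTransition t| ≤ C) (hM : ∀ y ∈ Ω, |fderiv ℝ ψ y (F y)| ≤ M)
    (hε : ∀ y ∈ tsupport ψ ∩ Ω, |g y| < 3 * δ → |ψ y * fderiv ℝ g y (F y)| ≤ ε) :
    |fluxPairing Ω F ψ - fluxPairing Ω F (innerCutoff ψ g δ)| ≤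
      (M + C / δ * ε) * volume.real (Ω ∩ (tsupport ψ ∩ g ⁻¹' Ioo (-(3 * δ)) 0)) := by
  refine abs_fluxPairing_sub_le hΩ.measurableSet hb hF hψ (hg.contDiff_innerCutoff hψ hψU)
    inter_subset_left (fun y hy => hg.fderiv_sub_fderiv_innerCutoff_eq_zero hU hδ hψU
      (sdiff_self_inter ▸ hy) _) fun y ⟨hy, hyψ, hgy⟩ =>
    (hg.abs_fderiv_sub_fderiv_innerCutoff_le hψ hδ hC (hψU hyψ) _).trans ?_
  have hC0 : 0 ≤ C := (abs_nonneg _).trans (hC 0)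
  have hgy' : |g y| < 3 * δ := abs_lt.2 ⟨hgy.1, by linarith [hgy.2]⟩
  exact add_le_add (hM y hy)
    (mul_le_mul_of_nonneg_left (hε y ⟨hyψ, hy⟩ hgy') (div_nonneg hC0 hδ.le))

theorem exists_forall_abs_fluxPairing_sub_innerCutoff_le (hg : IsLocalDefiningFunction Ω U g)
    (hU : IsOpen U) (hUb : Bornology.IsBounded U) {κ : ℝ}
    (hκ : ∀ a b, a ≤ b → volume.real (U ∩ g ⁻¹' Ioo a b) ≤ κ * (b - a)) (hΩ : IsOpen Ω)
    (hb : Bornology.IsBounded Ω) (hF : ContinuousOn F (closure Ω))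
    (hflux : ∀ y ν, IsOutwardUnitNormal Ω y ν → inner ℝ (F y) ν = 0)
    (hψ : ContDiff ℝ 1 ψ) (hψU : tsupport ψ ⊆ U) :
    ∃ B, ∀ ε > 0, ∃ δ > 0,
      |fluxPairing Ω F ψ - fluxPairing Ω F (innerCutoff ψ g δ)| ≤ B * ε := by
  obtain ⟨C, hC⟩ := exists_abs_deriv_smoothTransition_le
  obtain ⟨M, hM⟩ := hb.isCompact_closure.exists_bound_of_continuousOn
    ((hψ.continuous_fderiv one_ne_zero).continuousOn.clm_apply hF)
  have hC0 : 0 ≤ C := (abs_nonneg _).trans (hC 0)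
  have hκ0 : 0 ≤ κ := by simpa using measureReal_nonneg.trans (hκ 0 1 zero_le_one)
  refine ⟨3 * κ * (|M| + C), fun ε hε => ?_⟩
  have hK : tsupport ψ ∩ closure Ω ⊆ U := inter_subset_left.trans hψU
  obtain ⟨δ₀, hδ₀, h_small⟩ := exists_abs_lt_of_eq_zero_imp
    (hb.isCompact_closure.inter_left (isClosed_tsupport ψ))
    (hψ.continuous.continuousOn.mul
      ((hg.continuousOn_fderiv.mono hK).clm_apply (hF.mono inter_subset_right)))
    (hg.continuousOn.mono hK) (fun y hy hgy => by
      rw [Pi.mul_apply, hg.fderiv_apply_eq_zero hΩ hflux (hU.mem_nhds (hK hy)) hy.2 hgy,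
        mul_zero]) hε
  let δ := min (δ₀ / 3) ε
  have hδ : 0 < δ := lt_min (by positivity) hε
  have hδδ₀ : 3 * δ ≤ δ₀ := by linarith [min_le_left (δ₀ / 3) ε]
  refine ⟨δ, hδ, ?_⟩
  calc |fluxPairing Ω F ψ - fluxPairing Ω F (innerCutoff ψ g δ)|
      ≤ (|M| + C / δ * ε) * volume.real (Ω ∩ (tsupport ψ ∩ g ⁻¹' Ioo (-(3 * δ)) 0)) :=
        abs_fluxPairing_sub_innerCutoff_le hg hU hΩ hb hF hψ hψU hδ hC
          (fun y hy => (hM y (subset_closure hy)).trans (le_abs_self M))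
          fun y hy hgy => (h_small y ⟨hy.1, subset_closure hy.2⟩ (hgy.trans_le hδδ₀)).le
    _ ≤ (|M| + C / δ * ε) * (κ * (0 - -(3 * δ))) := by
        gcongr
        refine (measureReal_mono ?_
          (hUb.subset inter_subset_left).measure_lt_top.ne).trans (hκ _ _ (by linarith))
        exact inter_subset_right.trans (inter_subset_inter_left _ hψU)
    _ = 3 * κ * (|M| * δ + C * ε) := by
        field_simp
        ring
    _ ≤ 3 * κ * (|M| + C) * ε := by
        rw [mul_assoc _ _ ε, add_mul]
        gcongr
        exact min_le_right _ _

theorem fluxPairing_nonneg_of_isLocalDefiningFunction (hg : IsLocalDefiningFunction Ω U g)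
    (hU : IsOpen U) (hUb : Bornology.IsBounded U) {κ : ℝ}
    (hκ : ∀ a b, a ≤ b → volume.real (U ∩ g ⁻¹' Ioo a b) ≤ κ * (b - a)) (hΩ : IsOpen Ω)
    (hb : Bornology.IsBounded Ω) (hF : ContDiffOn ℝ 1 F Ω) (hFc : ContinuousOn F (closure Ω))
    (hdiv : ∀ x ∈ Ω, divergence F x ≤ 0)
    (hflux : ∀ y ν, IsOutwardUnitNormal Ω y ν → inner ℝ (F y) ν = 0)
    (hψ : ContDiff ℝ 1 ψ) (hψ0 : 0 ≤ ψ) (hψU : tsupport ψ ⊆ U) : 0 ≤ fluxPairing Ω F ψ := by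
  obtain ⟨B, hB⟩ := exists_forall_abs_fluxPairing_sub_innerCutoff_le hg hU hUb hκ hΩ hb hFc hflux
    hψ hψU
  by_contra! h_neg
  obtain ⟨ε, hε, hBε⟩ := exists_pos_mul_lt (neg_pos.2 h_neg) B
  obtain ⟨δ, hδ, h_close⟩ := hB ε hε
  have h_supp := hg.tsupport_innerCutoff_subset hδ hU hψU
  have h_nonneg : 0 ≤ fluxPairing Ω F (innerCutoff ψ g δ) :=
    fluxPairing_nonneg_of_tsupport_subset hΩ hF hdiv (hg.contDiff_innerCutoff hψ hψU)
      (innerCutoff_nonneg δ hψ0)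
      (hb.isCompact_closure.of_isClosed_subset (isClosed_tsupport _)
        (h_supp.trans subset_closure)) h_supp
  linarith [(abs_le.1 h_close).1]

theorem IsOutwardUnitNormal.exists_ball_fluxPairing_nonneg {x ν : Space n}
    (hν : IsOutwardUnitNormal Ω x ν) (hΩ : IsOpen Ω)
    (hb : Bornology.IsBounded Ω) (hF : ContDiffOn ℝ 1 F Ω) (hFc : ContinuousOn F (closure Ω))
    (hdiv : ∀ x ∈ Ω, divergence F x ≤ 0)
    (hflux : ∀ y ν, IsOutwardUnitNormal Ω y ν → inner ℝ (F y) ν = 0) :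
    ∃ r > 0, ∀ ψ : Space n → ℝ, ContDiff ℝ 1 ψ → 0 ≤ ψ → tsupport ψ ⊆ Metric.ball x r →
      0 ≤ fluxPairing Ω F ψ := by
  obtain ⟨U, hU, g, hg⟩ := hν.exists_isLocalDefiningFunction
  obtain ⟨s, hs, hsU⟩ := Metric.mem_nhds_iff.1 hU
  have hxU := mem_of_mem_nhds hU
  obtain ⟨r, hr, κ, hκ⟩ := exists_measureReal_ball_inter_preimage_Ioo_le volume
    (hg.contDiffAt x hxU) fun h0 => hg.gradient_ne_zero x hxU (by simp [gradient, h0])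
  refine ⟨min r s, lt_min hr hs, fun ψ hψ hψ0 hψs =>
    fluxPairing_nonneg_of_isLocalDefiningFunction (κ := κ)
      (hg.mono ((Metric.ball_subset_ball (min_le_right r s)).trans hsU))
      Metric.isOpen_ball Metric.isBounded_ball (fun a b hab => le_trans ?_ (hκ a b hab))
      hΩ hb hF hFc hdiv hflux hψ hψ0 hψs⟩
  exact measureReal_mono
    (inter_subset_inter_left _ (Metric.ball_subset_ball (min_le_left r s)))
    (Metric.isBounded_ball.subset inter_subset_left).measure_lt_top.ne

end InnerCutoff

section LocalToGlobal

variable {n : ℕ} {Ω : Set (Space n)} {F : Space n → Space n} {η θ : Space n → ℝ}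

theorem fluxPairing_nonneg_of_forall_exists_ball (hΩ : IsOpen Ω) (hb : Bornology.IsBounded Ω)
    (hF : ContinuousOn F (closure Ω)) (hη : ContDiff ℝ 1 η) (hη0 : 0 ≤ η)
    (h_local : ∀ x ∈ closure Ω ∩ tsupport η, ∃ r > 0, ∀ ψ : Space n → ℝ, ContDiff ℝ 1 ψ → 0 ≤ ψ →
      tsupport ψ ⊆ Metric.ball x r → 0 ≤ fluxPairing Ω F ψ) : 0 ≤ fluxPairing Ω F η := by
  have h_compact : IsCompact (closure Ω ∩ tsupport η) :=
    hb.isCompact_closure.inter_right (isClosed_tsupport η)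
  choose! r hr h_ball using h_local
  obtain ⟨t, ht, h_cover⟩ := h_compact.elim_nhds_subcover (fun x => Metric.ball x (r x))
    fun x hx => Metric.ball_mem_nhds x (hr x hx)
  obtain ⟨f, hf⟩ := SmoothPartitionOfUnity.exists_isSubordinate
    (modelWithCornersSelf ℝ (Space n)) h_compact.isClosed
    (fun i : t => Metric.ball (i : Space n) (r i)) (fun _ => Metric.isOpen_ball)
    (by simpa only [iUnion_subtype] using h_cover)
  have hfη : ∀ i, ContDiff ℝ 1 fun x => f i x * η x := fun i =>
    ((f i).contMDiff.contDiff.of_le (by simp)).mul hη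
  have h_sum : EqOn η (fun x => ∑ i, f i x * η x) Ω := fun x hx => by
    by_cases hx0 : η x = 0
    · simp [hx0]
    · have h_one := f.sum_eq_one (x := x) ⟨subset_closure hx, subset_tsupport η hx0⟩
      rw [finsum_eq_sum_of_fintype] at h_one
      simp only [← Finset.sum_mul, h_one, one_mul]
  rw [fluxPairing_congr hΩ h_sum, fluxPairing_finsetSum hb hF fun i _ => hfη i]
  exact Finset.sum_nonneg fun i _ => h_ball i (ht i i.2) _ (hfη i)
    (fun x => mul_nonneg (f.nonneg i x) (hη0 x)) (tsupport_mul_subset_left.trans (hf i))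

theorem fluxPairing_nonneg_of_disjoint_singularBoundary (hΩ : IsOpen Ω)
    (hb : Bornology.IsBounded Ω) (hF : ContDiffOn ℝ 1 F Ω) (hFc : ContinuousOn F (closure Ω))
    (hdiv : ∀ x ∈ Ω, divergence F x ≤ 0)
    (hflux : ∀ x ν, IsOutwardUnitNormal Ω x ν → inner ℝ (F x) ν = 0)
    (hη : ContDiff ℝ 1 η) (hη0 : 0 ≤ η) (hd : Disjoint (tsupport η) (singularBoundary Ω)) :
    0 ≤ fluxPairing Ω F η := by
  refine fluxPairing_nonneg_of_forall_exists_ball hΩ hb hFc hη hη0 fun x ⟨hx, hxη⟩ => ?_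
  rcases mem_or_exists_isOutwardUnitNormal hΩ hx (disjoint_left.1 hd hxη) with hxΩ | ⟨ν, hν⟩
  · obtain ⟨r, hr, h_ball⟩ := Metric.isOpen_iff.1 hΩ x hxΩ
    exact ⟨r, hr, fun ψ hψ hψ0 hψs => fluxPairing_nonneg_of_tsupport_subset hΩ hF hdiv hψ hψ0
      ((isCompact_closedBall x r).of_isClosed_subset (isClosed_tsupport ψ)
        (hψs.trans Metric.ball_subset_closedBall)) (hψs.trans h_ball)⟩
  · exact hν.exists_ball_fluxPairing_nonneg hΩ hb hF hFc hdiv hflux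

theorem fluxPairing_mono_of_disjoint_singularBoundary (hΩ : IsOpen Ω)
    (hb : Bornology.IsBounded Ω) (hF : ContDiffOn ℝ 1 F Ω) (hFc : ContinuousOn F (closure Ω))
    (hdiv : ∀ x ∈ Ω, divergence F x ≤ 0)
    (hflux : ∀ x ν, IsOutwardUnitNormal Ω x ν → inner ℝ (F x) ν = 0)
    (hθ : ContDiff ℝ 1 θ) (hη : ContDiff ℝ 1 η) (hθη : θ ≤ η)
    (hθd : Disjoint (tsupport θ) (singularBoundary Ω))
    (hηd : Disjoint (tsupport η) (singularBoundary Ω)) :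
    fluxPairing Ω F θ ≤ fluxPairing Ω F η := by
  rw [← sub_nonneg, ← fluxPairing_sub hb hFc hη hθ]
  exact fluxPairing_nonneg_of_disjoint_singularBoundary hΩ hb hF hFc hdiv hflux (hη.sub hθ)
    (fun x => sub_nonneg.2 (hθη x)) ((hηd.union_left hθd).mono_left (tsupport_sub η θ))

end LocalToGlobal

section Cutoff

open scoped ENNReal NNReal

theorem exists_pos_lt_rpow_lt_add {a ρ δ : ℝ≥0∞} {d : ℝ} (hd : 0 ≤ d) (ha : a < ρ)
    (hδ : δ ≠ 0) :
    ∃ r : ℝ, 0 < r ∧ a < ENNReal.ofReal r ∧ ENNReal.ofReal r < ρ ∧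
      ENNReal.ofReal r ^ d < a ^ d + δ := by
  have h_lt : a ^ d < a ^ d + δ :=
    ENNReal.lt_add_right (ENNReal.rpow_ne_top_of_nonneg hd (ha.trans_le le_top).ne) hδ
  have h_pow : ∀ᶠ y in 𝓝 a, y ^ d < a ^ d + δ :=
    ENNReal.continuous_rpow_const.continuousAt.eventually (gt_mem_nhds h_lt)
  have : (𝓝[>] a).NeBot := nhdsGT_neBot_of_exists_gt ⟨ρ, ha⟩
  obtain ⟨y, ⟨hyd, hyρ⟩, hay⟩ :=
    (((h_pow.and (gt_mem_nhds ha)).filter_mono nhdsWithin_le_nhds).and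
      (self_mem_nhdsWithin (s := Ioi a))).exists
  have hy : y ≠ ∞ := (hyρ.trans_le le_top).ne
  refine ⟨y.toReal, ENNReal.toReal_pos (pos_of_gt hay).ne' hy, ?_⟩
  rw [ENNReal.ofReal_toReal hy]
  exact ⟨hay, hyρ, hyd⟩

theorem exists_ball_superset_rpow_le {X : Type*} [PseudoMetricSpace X] {A : Set X} {x : X}
    (hx : x ∈ A) {ρ d : ℝ} {δ : ℝ≥0∞} (hd : 0 ≤ d) (hA : Metric.ediam A < ENNReal.ofReal ρ)
    (hδ : δ ≠ 0) :
    ∃ r : ℝ, 0 < r ∧ r < ρ ∧ A ⊆ Metric.ball x r ∧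
      ENNReal.ofReal r ^ d ≤ Metric.ediam A ^ d + δ := by
  obtain ⟨r, hr, hAr, hrρ, hrd⟩ := exists_pos_lt_rpow_lt_add hd hA hδ
  refine ⟨r, hr, (ENNReal.ofReal_lt_ofReal_iff_of_nonneg hr.le).1 hrρ, fun z hz => ?_, hrd.le⟩
  rw [← Metric.eball_ofReal]
  exact (Metric.edist_le_ediam_of_mem hz hx).trans_lt hAr

variable {X : Type*} [MetricSpace X] [MeasurableSpace X] [BorelSpace X]

theorem exists_iUnion_superset_of_hausdorffMeasure_eq_zero {E : Set X} {d : ℝ}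
    (h : μH[d] E = 0) {ρ ε : ℝ≥0∞} (hρ : 0 < ρ) (hε : 0 < ε) :
    ∃ s : ℕ → Set X, E ⊆ ⋃ i, s i ∧ (∀ i, Metric.ediam (s i) ≤ ρ) ∧
      ∑' i, ⨆ _ : (s i).Nonempty, Metric.ediam (s i) ^ d < ε := by
  rw [Measure.hausdorffMeasure_apply] at h
  simpa only [iInf_lt_iff, exists_prop] using (iSup₂_eq_bot.1 h ρ hρ).trans_lt hε

theorem exists_finite_ball_cover_of_hausdorffMeasure_eq_zero [Nonempty X] {E : Set X}
    (hE : IsCompact E) {d : ℝ} (hd : 0 ≤ d) (h : μH[d] E = 0) {ε : ℝ≥0∞} (hε : 0 < ε) {ρ : ℝ}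
    (hρ : 0 < ρ) :
    ∃ (t : Finset ℕ) (c : ℕ → X) (r : ℕ → ℝ), (∀ i ∈ t, c i ∈ E ∧ 0 < r i ∧ r i < ρ) ∧
      E ⊆ ⋃ i ∈ t, Metric.ball (c i) (r i) ∧ ∑ i ∈ t, ENNReal.ofReal (r i) ^ d ≤ ε := by
  have hε2 : 0 < ε / 2 := ENNReal.half_pos hε.ne'
  have hρ2 : ENNReal.ofReal (ρ / 2) < ENNReal.ofReal ρ :=
    (ENNReal.ofReal_lt_ofReal_iff hρ).2 (half_lt_self hρ)
  obtain ⟨s, hEs, hs, h_sum⟩ := exists_iUnion_superset_of_hausdorffMeasure_eq_zero h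
    (ENNReal.ofReal_pos.2 (half_pos hρ)) hε2
  obtain ⟨δ, hδ, hδ_sum⟩ := ENNReal.exists_pos_sum_of_countable' hε2.ne' ℕ
  have h_ball : ∀ i, (s i ∩ E).Nonempty → ∃ (x : X) (r : ℝ), x ∈ E ∧ 0 < r ∧ r < ρ ∧
      s i ⊆ Metric.ball x r ∧ ENNReal.ofReal r ^ d ≤ Metric.ediam (s i) ^ d + δ i := by
    rintro i ⟨x, hxs, hxE⟩
    obtain ⟨r, hr⟩ := exists_ball_superset_rpow_le hxs hd ((hs i).trans_lt hρ2) (hδ i).ne'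
    exact ⟨x, r, hxE, hr⟩
  choose! c r hcE hr0 hrρ h_sub h_pow using h_ball
  obtain ⟨T, hT, hT_fin, h_cover⟩ := hE.elim_finite_subcover_image
    (b := {i | (s i ∩ E).Nonempty}) (c := fun i => Metric.ball (c i) (r i))
    (fun i _ => Metric.isOpen_ball) fun x hx => by
      obtain ⟨i, hi⟩ := mem_iUnion.1 (hEs hx)
      exact mem_iUnion₂.2 ⟨i, ⟨x, hi, hx⟩, h_sub i ⟨x, hi, hx⟩ hi⟩
  have hT' : ∀ i ∈ hT_fin.toFinset, (s i ∩ E).Nonempty := fun i hi => hT (hT_fin.mem_toFinset.1 hi)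
  refine ⟨hT_fin.toFinset, c, r, fun i hi => ⟨hcE i (hT' i hi), hr0 i (hT' i hi), hrρ i (hT' i hi)⟩,
    by simpa using h_cover, ?_⟩
  calc ∑ i ∈ hT_fin.toFinset, ENNReal.ofReal (r i) ^ d
      ≤ ∑ i ∈ hT_fin.toFinset, ((⨆ _ : (s i).Nonempty, Metric.ediam (s i) ^ d) + δ i) :=
        Finset.sum_le_sum fun i hi => (h_pow i (hT' i hi)).trans <| by
          rw [ciSup_pos ((hT' i hi).mono inter_subset_left)]
    _ ≤ ε / 2 + ε / 2 := by
        rw [Finset.sum_add_distrib]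
        exact add_le_add ((ENNReal.sum_le_tsum _).trans h_sum.le)
          ((ENNReal.sum_le_tsum _).trans hδ_sum.le)
    _ = ε := ENNReal.add_halves ε

theorem norm_fderiv_prod_one_sub_le {E ι : Type*} [NormedAddCommGroup E] [NormedSpace ℝ E]
    {b : ι → E → ℝ} {t : Finset ι} (hb : ∀ i ∈ t, Differentiable ℝ (b i))
    (h0 : ∀ i ∈ t, 0 ≤ b i) (h1 : ∀ i ∈ t, b i ≤ 1) (x : E) :
    ‖fderiv ℝ (fun y => ∏ i ∈ t, (1 - b i y)) x‖ ≤ ∑ i ∈ t, ‖fderiv ℝ (b i) x‖ := by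
  classical
  have h_deriv : ∀ i ∈ t, HasFDerivAt (fun y => 1 - b i y) (-fderiv ℝ (b i) x) x := fun i hi =>
    (hb i hi x).hasFDerivAt.const_sub 1
  rw [(HasFDerivAt.finsetProd h_deriv).fderiv]
  refine norm_sum_le_of_le t fun i _ => ?_
  rw [norm_smul, norm_neg, norm_prod]
  refine mul_le_of_le_one_left (norm_nonneg _) (Finset.prod_le_one (fun _ _ => norm_nonneg _)
    fun j hj => ?_)
  have hj0 := h0 j (Finset.mem_of_mem_erase hj) x
  have hj1 := h1 j (Finset.mem_of_mem_erase hj) x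
  simp only [Pi.zero_apply, Pi.one_apply] at hj0 hj1
  rw [Real.norm_of_nonneg (by linarith)]
  linarith

theorem lintegral_enorm_fderiv_prod_one_sub_le {E ι : Type*} [NormedAddCommGroup E]
    [NormedSpace ℝ E] [MeasurableSpace E] [BorelSpace E] {ν : Measure E} {b : ι → E → ℝ}
    {t : Finset ι} (hb : ∀ i ∈ t, ContDiff ℝ 1 (b i)) (h0 : ∀ i ∈ t, 0 ≤ b i)
    (h1 : ∀ i ∈ t, b i ≤ 1) :
    ∫⁻ x, ‖fderiv ℝ (fun y => ∏ i ∈ t, (1 - b i y)) x‖ₑ ∂ν ≤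
      ∑ i ∈ t, ∫⁻ x, ‖fderiv ℝ (b i) x‖ₑ ∂ν := by
  rw [← lintegral_finsetSum' _ fun i hi =>
    ((hb i hi).continuous_fderiv one_ne_zero).enorm.measurable.aemeasurable]
  refine lintegral_mono fun x => ?_
  simp only [← ofReal_norm]
  rw [← ENNReal.ofReal_sum_of_nonneg fun i _ => norm_nonneg _]
  exact ENNReal.ofReal_le_ofReal (norm_fderiv_prod_one_sub_le
    (fun i hi => (hb i hi).differentiable one_ne_zero) h0 h1 x)

variable {E : Type*} [NormedAddCommGroup E] [NormedSpace ℝ E] [FiniteDimensional ℝ E]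
  [MeasurableSpace E] [BorelSpace E] (ν : Measure E) [ν.IsAddHaarMeasure]

theorem lintegral_enorm_fderiv_comp_smul_sub (f : E → ℝ) (c : E) {r : ℝ} (hr : 0 < r) :
    ∫⁻ x, ‖fderiv ℝ (fun y => f (r⁻¹ • (y - c))) x‖ₑ ∂ν =
      (∫⁻ x, ‖fderiv ℝ f x‖ₑ ∂ν) * ENNReal.ofReal r ^ ((Module.finrank ℝ E : ℝ) - 1) := by
  have h_fderiv : ∀ x, fderiv ℝ (fun y => f (r⁻¹ • (y - c))) x =
      r⁻¹ • fderiv ℝ f (r⁻¹ • (x - c)) := fun x => by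
    rw [fderiv_comp_sub (f := fun y => f (r⁻¹ • y)), fderiv_comp_smul]
  have h_scale : ∫⁻ x, ‖fderiv ℝ f (r⁻¹ • x)‖ₑ ∂ν =
      ENNReal.ofReal (r ^ Module.finrank ℝ E) * ∫⁻ x, ‖fderiv ℝ f x‖ₑ ∂ν := by
    refine ((Homeomorph.smulOfNeZero r⁻¹ (inv_ne_zero hr.ne')).measurableEmbedding.lintegral_map
      fun x => ‖fderiv ℝ f x‖ₑ).symm.trans ?_
    change ∫⁻ x, _ ∂Measure.map (r⁻¹ • ·) ν = _
    rw [Measure.map_addHaar_smul ν (inv_ne_zero hr.ne'), lintegral_smul_measure, inv_pow, inv_inv,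
      abs_of_pos (pow_pos hr _), smul_eq_mul]
  simp only [h_fderiv, enorm_smul]
  rw [lintegral_const_mul' _ _ enorm_ne_top,
    lintegral_sub_right_eq_self (fun x => ‖fderiv ℝ f (r⁻¹ • x)‖ₑ) c, h_scale, ← mul_assoc,
    mul_comm, ENNReal.ofReal_rpow_of_pos hr, Real.enorm_of_nonneg (inv_nonneg.2 hr.le),
    ← ENNReal.ofReal_mul (inv_nonneg.2 hr.le), Real.rpow_sub_one hr.ne', Real.rpow_natCast,
    inv_mul_eq_div]

theorem exists_lintegral_enorm_fderiv_contDiffBump_le :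
    ∃ κ ≠ ∞, ∀ (c : E) (b : ContDiffBump c), b.rOut = 2 * b.rIn →
      ∫⁻ x, ‖fderiv ℝ b x‖ₑ ∂ν ≤
        κ * ENNReal.ofReal b.rIn ^ ((Module.finrank ℝ E : ℝ) - 1) := by
  let b₀ : ContDiffBump (0 : E) := ⟨1, 2, one_pos, one_lt_two⟩
  have h_int : Integrable (fderiv ℝ b₀) ν :=
    ((b₀.contDiff (n := 1)).continuous_fderiv one_ne_zero).integrable_of_hasCompactSupport
      (b₀.hasCompactSupport.fderiv ℝ)
  refine ⟨∫⁻ x, ‖fderiv ℝ b₀ x‖ₑ ∂ν, h_int.hasFiniteIntegral.ne, fun c b hb => ?_⟩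
  have h_scale : (b : E → ℝ) = fun x => b₀ (b.rIn⁻¹ • (x - c)) := by
    ext x
    simp [ContDiffBump.apply, b₀, hb, b.rIn_pos.ne']
  rw [h_scale]
  exact (lintegral_enorm_fderiv_comp_smul_sub ν b₀ c b.rIn_pos).le

theorem exists_contDiff_cutoff_lintegral_enorm_fderiv_le {S K : Set E} (hS : IsCompact S)
    (hK : IsClosed K) (hSK : Disjoint S K) (hn : 1 ≤ Module.finrank ℝ E)
    (h : μH[(Module.finrank ℝ E : ℝ) - 1] S = 0) {ε : ℝ≥0∞} (hε : ε ≠ 0) :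
    ∃ η : E → ℝ, ContDiff ℝ 1 η ∧ 0 ≤ η ∧ Disjoint (tsupport η) S ∧ EqOn η 1 K ∧
      ∫⁻ x, ‖fderiv ℝ η x‖ₑ ∂ν ≤ ε := by
  obtain ⟨κ, hκ, h_bump⟩ := exists_lintegral_enorm_fderiv_contDiffBump_le ν
  obtain ⟨ε', hε', hκε'⟩ := ENNReal.exists_nnreal_pos_mul_lt hκ hε
  obtain ⟨ρ, hρ, hρK⟩ := hS.exists_thickening_subset_open hK.isOpen_compl
    (disjoint_left.1 hSK)
  obtain ⟨t, c, r, ht, h_cover, h_sum⟩ := exists_finite_ball_cover_of_hausdorffMeasure_eq_zero hS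
    (sub_nonneg.2 (by exact_mod_cast hn)) h (ENNReal.coe_pos.2 hε') (half_pos hρ)
  let b (i : t) : ContDiffBump (c i) :=
    ⟨r i, 2 * r i, (ht i i.2).2.1, by linarith [(ht i i.2).2.1]⟩
  refine ⟨fun x => ∏ i, (1 - b i x), contDiff_prod fun i _ => contDiff_const.sub (b i).contDiff,
    fun x => Finset.prod_nonneg fun i _ => sub_nonneg.2 (b i).le_one,
    disjoint_right.2 fun x hx => notMem_tsupport_iff_eventuallyEq.2 ?_, fun x hx => ?_, ?_⟩
  · obtain ⟨i, hi, hxi⟩ := mem_iUnion₂.1 (h_cover hx)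
    filter_upwards [Metric.isOpen_ball.mem_nhds hxi] with y hy
    exact Finset.prod_eq_zero (Finset.mem_univ ⟨i, hi⟩)
      (sub_eq_zero.2 ((b ⟨i, hi⟩).one_of_mem_closedBall (Metric.ball_subset_closedBall hy)).symm)
  · refine Finset.prod_eq_one fun i _ => ?_
    have h_far : ρ ≤ dist x (c i) := not_lt.1 fun hlt =>
      hρK (Metric.mem_thickening_iff.2 ⟨c i, (ht i i.2).1, hlt⟩) hx
    have h_out : (b i).rOut ≤ dist x (c i) := by
      change 2 * r i ≤ _
      linarith [(ht i i.2).2.2]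
    rw [(b i).zero_of_le_dist h_out, sub_zero]
  · calc ∫⁻ x, ‖fderiv ℝ (fun x => ∏ i, (1 - b i x)) x‖ₑ ∂ν
        ≤ ∑ i, ∫⁻ x, ‖fderiv ℝ (b i) x‖ₑ ∂ν := lintegral_enorm_fderiv_prod_one_sub_le
          (fun i _ => (b i).contDiff) (fun i _ _ => (b i).nonneg) fun i _ _ => (b i).le_one
      _ ≤ ∑ i : t, κ * ENNReal.ofReal (r i) ^ ((Module.finrank ℝ E : ℝ) - 1) :=
          Finset.sum_le_sum fun i _ => h_bump _ (b i) rfl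
      _ ≤ κ * ε' := by
          rw [← Finset.mul_sum, Finset.sum_coe_sort t fun i => ENNReal.ofReal (r i) ^ _]
          gcongr
      _ ≤ ε := by
          rw [mul_comm]
          exact hκε'.le

end Cutoff

section DivergenceFree

variable {n : ℕ} {Ω : Set (Space n)} {F : Space n → Space n}

theorem divergence_eq_zero_of_nonpos (hn : 1 ≤ n) (hΩ : IsOpen Ω) (hb : Bornology.IsBounded Ω)
    (hs : HasPiecewiseSmoothBoundary Ω) (hF : ContDiffOn ℝ 1 F Ω)
    (hFc : ContinuousOn F (closure Ω)) (hdiv : ∀ x ∈ Ω, divergence F x ≤ 0)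
    (hflux : ∀ x ν, IsOutwardUnitNormal Ω x ν → inner ℝ (F x) ν = 0) {x₀ : Space n}
    (hx₀ : x₀ ∈ Ω) : divergence F x₀ = 0 := by
  by_contra h_ne
  obtain ⟨θ, hθΩ, hθc, hθ, hθ_range, hθx₀⟩ :=
    exists_contDiff_tsupport_subset (n := 1) (hΩ.mem_nhds hx₀)
  have hθ0 : 0 ≤ θ := fun x => (hθ_range (mem_range_self x)).1
  have hθ_pos : 0 < fluxPairing Ω F θ := fluxPairing_pos_of_tsupport_subset hΩ hF hdiv hθ hθ0 hθc
    hθΩ (hθx₀.trans_ne one_ne_zero) h_ne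
  obtain ⟨M, hM⟩ := hb.isCompact_closure.exists_bound_of_continuousOn hFc
  obtain ⟨ε, hε, hMε⟩ := ENNReal.exists_nnreal_pos_mul_lt (ENNReal.ofReal_ne_top (r := M))
    (ENNReal.ofReal_pos.2 hθ_pos).ne'
  have h_disj : Disjoint (tsupport θ) (singularBoundary Ω) :=
    (disjoint_frontier_iff_isOpen.2 hΩ).symm.mono hθΩ (sep_subset _ _)
  obtain ⟨η, hη, hη0, hη_disj, hη1, h_int⟩ :=
    exists_contDiff_cutoff_lintegral_enorm_fderiv_le volume
      (hb.isCompact_closure.of_isClosed_subset isClosed_singularBoundary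
        ((sep_subset _ _).trans frontier_subset_closure))
      (isClosed_tsupport θ) h_disj.symm (by simpa using hn)
      (by rwa [finrank_euclideanSpace_fin]) (ENNReal.coe_pos.2 hε).ne'
  have hθη : θ ≤ η := fun x => by
    by_cases hx : x ∈ tsupport θ
    · rw [hη1 hx]
      exact (hθ_range (mem_range_self x)).2
    · rw [image_eq_zero_of_notMem_tsupport hx]
      exact hη0 x
  -- `η - θ` is an admissible test function, so the small flux of `η` dominates that of `θ`.
  have h_le := fluxPairing_mono_of_disjoint_singularBoundary hΩ hb hF hFc hdiv hflux hθ hη hθη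
    h_disj hη_disj
  refine (hMε.trans_le (ENNReal.ofReal_le_ofReal h_le)).not_ge ?_
  calc ENNReal.ofReal (fluxPairing Ω F η) ≤ ‖fluxPairing Ω F η‖ₑ := Real.ofReal_le_enorm _
    _ ≤ (∫⁻ x, ‖fderiv ℝ η x‖ₑ) * ENNReal.ofReal M :=
        enorm_fluxPairing_le hΩ.measurableSet fun x hx => hM x (subset_closure hx)
    _ ≤ ε * ENNReal.ofReal M := by gcongr

end DivergenceFree

section Flows

variable {n : ℕ} {Ω : Set (Space n)}

theorem IsPositiveDefinite.isUnit_det {A : Matrix (Fin n) (Fin n) ℝ} (hA : IsPositiveDefinite A) :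
    IsUnit A.det := by
  refine isUnit_iff_ne_zero.2 fun h0 => ?_
  obtain ⟨v, hv, hAv⟩ := Matrix.exists_mulVec_eq_zero_iff.2 h0
  have h_pos := hA (WithLp.toLp 2 v) fun h => hv (by simpa using congrArg WithLp.ofLp h)
  simp [Matrix.toLpLin_toLp, hAv] at h_pos

theorem IsPositiveDefinite.inv {A : Matrix (Fin n) (Fin n) ℝ} (hA : IsPositiveDefinite A) :
    IsPositiveDefinite A⁻¹ := by
  intro ξ hξ
  have h_apply : Matrix.toEuclideanLin A (Matrix.toEuclideanLin A⁻¹ ξ) = ξ := by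
    ext i
    simp [Matrix.toLpLin_apply, Matrix.mulVec_mulVec, Matrix.mul_nonsing_inv A hA.isUnit_det]
  have h_pos := hA (Matrix.toEuclideanLin A⁻¹ ξ) fun h => hξ (by rw [← h_apply, h, map_zero])
  rwa [h_apply, real_inner_comm] at h_pos

namespace Network

/-- The flux `(p - p') φ (v - v')` of the power which the difference of two flows of a network
transports. -/
def energyFlux (N : Network n) (v v' : Space n → Space n) (p p' : Space n → ℝ) :
    Space n → Space n :=
  fun x => (p x - p' x) • (N.discharge v x - N.discharge v' x)

/-- The power density `μ φ² ⟪K⁻¹ (v - v'), v - v'⟫` which the difference of two flows of a network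
dissipates through drag. -/
noncomputable def dissipation (N : Network n) (μ : ℝ) (v v' : Space n → Space n)
    (x : Space n) : ℝ :=
  μ * N.φ x ^ 2 * inner ℝ (Matrix.toEuclideanLin (N.K x)⁻¹ (v x - v' x)) (v x - v' x)

variable {N : Network n} {μ γ : ℝ} {b : Space n → Space n} {s s' : Space n → ℝ}
  {v v' : Space n → Space n} {p p' : Space n → ℝ} {x : Space n}

theorem IsAdmissible.dissipation_nonneg (hN : N.IsAdmissible Ω) (hμ : 0 < μ) (hx : x ∈ Ω) :
    0 ≤ N.dissipation μ v v' x := by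
  refine mul_nonneg (by positivity) ?_
  by_cases hv : v x - v' x = 0
  · simp [hv]
  · exact ((hN.permeability_pos x hx).inv _ hv).le

theorem IsAdmissible.eq_of_dissipation_eq_zero (hN : N.IsAdmissible Ω) (hμ : 0 < μ) (hx : x ∈ Ω)
    (h : N.dissipation μ v v' x = 0) : v x = v' x := by
  have hφ := hN.porosity_pos x (subset_closure hx)
  by_contra hv
  exact (mul_pos (by positivity) ((hN.permeability_pos x hx).inv _ (sub_ne_zero.2 hv))).ne' h

theorem IsAdmissible.Γp_subset_closure (hN : N.IsAdmissible Ω) : N.Γp ⊆ closure Ω :=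
  (subset_union_right.trans hN.boundary_union.subset).trans frontier_subset_closure

namespace IsClassicalFlow

theorem differentiableAt_pressure (h : N.IsClassicalFlow Ω μ γ b s v p) (hΩ : IsOpen Ω)
    (hx : x ∈ Ω) : DifferentiableAt ℝ p x :=
  (h.pressure_contDiff.differentiableOn one_ne_zero).differentiableAt (hΩ.mem_nhds hx)

theorem differentiableAt_discharge (h : N.IsClassicalFlow Ω μ γ b s v p) (hΩ : IsOpen Ω)
    (hx : x ∈ Ω) : DifferentiableAt ℝ (N.discharge v) x :=
  (h.discharge_contDiff.differentiableOn one_ne_zero).differentiableAt (hΩ.mem_nhds hx)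

theorem contDiffOn_energyFlux (h : N.IsClassicalFlow Ω μ γ b s v p)
    (h' : N.IsClassicalFlow Ω μ γ b s' v' p') : ContDiffOn ℝ 1 (N.energyFlux v v' p p') Ω :=
  (h.pressure_contDiff.sub h'.pressure_contDiff).smul
    (h.discharge_contDiff.sub h'.discharge_contDiff)

theorem continuousOn_energyFlux (h : N.IsClassicalFlow Ω μ γ b s v p)
    (h' : N.IsClassicalFlow Ω μ γ b s' v' p') :
    ContinuousOn (N.energyFlux v v' p p') (closure Ω) :=
  (h.pressure_continuous.sub h'.pressure_continuous).smul
    (h.discharge_continuous.sub h'.discharge_continuous)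

theorem inner_energyFlux_eq_zero (h : N.IsClassicalFlow Ω μ γ b s v p)
    (h' : N.IsClassicalFlow Ω μ γ b s' v' p') (hN : N.IsAdmissible Ω) {ν : Space n}
    (hν : IsOutwardUnitNormal Ω x ν) : inner ℝ (N.energyFlux v v' p p' x) ν = 0 := by
  have hx : x ∈ N.Γv ∪ N.Γp := hN.boundary_union ▸ hν.1
  rw [energyFlux, inner_smul_left, discharge, discharge, ← smul_sub, inner_smul_left,
    inner_sub_left]
  rcases hx with hx | hx
  · rw [h.velocity_bc x hx ν hν, h'.velocity_bc x hx ν hν, sub_self, mul_zero, mul_zero]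
  · rw [h.pressure_bc x hx, h'.pressure_bc x hx, sub_self, map_zero, zero_mul]

theorem gradient_pressure_sub (h : N.IsClassicalFlow Ω μ γ b s v p)
    (h' : N.IsClassicalFlow Ω μ γ b s' v' p') (hN : N.IsAdmissible Ω) (hΩ : IsOpen Ω)
    (hx : x ∈ Ω) : gradient (fun y => p y - p' y) x =
      -((μ * N.φ x) • Matrix.toEuclideanLin (N.K x)⁻¹ (v x - v' x)) := by
  have hφ := (hN.porosity_pos x (subset_closure hx)).ne'
  have h_grad : gradient (fun y => p y - p' y) x = gradient p x - gradient p' x := by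
    simp only [gradient, fderiv_fun_sub (h.differentiableAt_pressure hΩ hx)
      (h'.differentiableAt_pressure hΩ hx), map_sub]
  have h_momentum := sub_eq_zero.2 ((h.momentum x hx).trans (h'.momentum x hx).symm)
  refine smul_right_injective (Space n) hφ (sub_eq_zero.1 (Eq.trans ?_ h_momentum))
  simp only [h_grad, map_sub]
  module

theorem fderiv_pressure_sub_apply_discharge_sub (h : N.IsClassicalFlow Ω μ γ b s v p)
    (h' : N.IsClassicalFlow Ω μ γ b s' v' p') (hN : N.IsAdmissible Ω) (hΩ : IsOpen Ω)
    (hx : x ∈ Ω) : fderiv ℝ (fun y => p y - p' y) x (N.discharge v x - N.discharge v' x) =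
      -N.dissipation μ v v' x := by
  rw [← inner_gradient_left, h.gradient_pressure_sub h' hN hΩ hx, discharge, discharge,
    ← smul_sub, inner_neg_left, real_inner_smul_left, real_inner_smul_right, dissipation]
  ring

theorem divergence_energyFlux (h : N.IsClassicalFlow Ω μ γ b s v p)
    (h' : N.IsClassicalFlow Ω μ γ b s' v' p') (hN : N.IsAdmissible Ω) (hΩ : IsOpen Ω)
    (hx : x ∈ Ω) : divergence (N.energyFlux v v' p p') x =
      (p x - p' x) * (s x - s' x) - N.dissipation μ v v' x := by
  have hw := h.differentiableAt_discharge hΩ hx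
  have hw' := h'.differentiableAt_discharge hΩ hx
  have hq := (h.differentiableAt_pressure hΩ hx).fun_sub (h'.differentiableAt_pressure hΩ hx)
  unfold energyFlux
  rw [divergence_smul hq (hw.fun_sub hw'), divergence_sub hw hw', h.mass_balance x hx,
    h'.mass_balance x hx, h.fderiv_pressure_sub_apply_discharge_sub h' hN hΩ hx]
  ring

theorem eqOn_closure_of_eqOn (h : N.IsClassicalFlow Ω μ γ b s v p)
    (h' : N.IsClassicalFlow Ω μ γ b s' v' p') (hN : N.IsAdmissible Ω) (hv : EqOn v v' Ω) :
    EqOn v v' (closure Ω) := by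
  have h_discharge : EqOn (N.discharge v) (N.discharge v') (closure Ω) :=
    EqOn.of_subset_closure (fun x hx => by simp only [discharge, hv hx])
      h.discharge_continuous h'.discharge_continuous subset_closure subset_rfl
  exact fun x hx => smul_right_injective (Space n) (hN.porosity_pos x hx).ne' (h_discharge hx)

theorem exists_forall_pressure_eq_add (h : N.IsClassicalFlow Ω μ γ b s v p)
    (h' : N.IsClassicalFlow Ω μ γ b s' v' p') (hN : N.IsAdmissible Ω) (hΩ : IsOpen Ω)
    (hΩc : IsPreconnected Ω) (hv : EqOn v v' Ω) : ∃ c : ℝ, ∀ x ∈ closure Ω, p x = p' x + c := by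
  have h_diff : DifferentiableOn ℝ (fun y => p y - p' y) Ω := fun x hx =>
    ((h.differentiableAt_pressure hΩ hx).fun_sub
      (h'.differentiableAt_pressure hΩ hx)).differentiableWithinAt
  have h_fderiv : EqOn (fderiv ℝ fun y => p y - p' y) 0 Ω := fun x hx => by
    have h_grad := h.gradient_pressure_sub h' hN hΩ hx
    rwa [hv hx, sub_self, map_zero, smul_zero, neg_zero, gradient, map_eq_zero_iff _
      (InnerProductSpace.toDual ℝ (Space n)).symm.injective] at h_grad
  obtain ⟨c, hc⟩ := hΩ.exists_is_const_of_fderiv_eq_zero hΩc h_diff h_fderiv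
  have h_closure : EqOn (fun y => p y - p' y) (fun _ => c) (closure Ω) :=
    EqOn.of_subset_closure hc (h.pressure_continuous.sub h'.pressure_continuous)
      continuousOn_const subset_closure subset_rfl
  exact ⟨c, fun x hx => eq_add_of_sub_eq' (h_closure hx)⟩

end IsClassicalFlow

end Network

namespace IsClassicalSolution

variable {N₁ N₂ : Network n} {μ β γ : ℝ} {b v₁ v₂ v₁' v₂' : Space n → Space n}
  {p₁ p₂ χ p₁' p₂' χ' : Space n → ℝ} {x : Space n}

theorem divergence_energyFlux_add (h : IsClassicalSolution Ω N₁ N₂ μ β γ b v₁ v₂ p₁ p₂ χ)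
    (h' : IsClassicalSolution Ω N₁ N₂ μ β γ b v₁' v₂' p₁' p₂' χ') (hN₁ : N₁.IsAdmissible Ω)
    (hN₂ : N₂.IsAdmissible Ω) (hΩ : IsOpen Ω) (hx : x ∈ Ω) :
    divergence (fun y => N₁.energyFlux v₁ v₁' p₁ p₁' y + N₂.energyFlux v₂ v₂' p₂ p₂' y) x =
      -(N₁.dissipation μ v₁ v₁' x + N₂.dissipation μ v₂ v₂' x +
        β / μ * ((p₁ x - p₁' x) - (p₂ x - p₂' x)) ^ 2) := by
  rw [divergence_add
      (((h.flow₁.contDiffOn_energyFlux h'.flow₁).contDiffAt (hΩ.mem_nhds hx)).differentiableAt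
        one_ne_zero)
      (((h.flow₂.contDiffOn_energyFlux h'.flow₂).contDiffAt (hΩ.mem_nhds hx)).differentiableAt
        one_ne_zero),
    h.flow₁.divergence_energyFlux h'.flow₁ hN₁ hΩ hx,
    h.flow₂.divergence_energyFlux h'.flow₂ hN₂ hΩ hx, h.mass_transfer x hx, h'.mass_transfer x hx]
  ring

theorem eq_and_eq_and_sub_eq_sub (h : IsClassicalSolution Ω N₁ N₂ μ β γ b v₁ v₂ p₁ p₂ χ)
    (h' : IsClassicalSolution Ω N₁ N₂ μ β γ b v₁' v₂' p₁' p₂' χ') (hn : 1 ≤ n)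
    (hN₁ : N₁.IsAdmissible Ω) (hN₂ : N₂.IsAdmissible Ω) (hμ : 0 < μ) (hβ : 0 < β)
    (hΩ : IsOpen Ω) (hb : Bornology.IsBounded Ω) (hs : HasPiecewiseSmoothBoundary Ω)
    (hx : x ∈ Ω) : v₁ x = v₁' x ∧ v₂ x = v₂' x ∧ p₁ x - p₁' x = p₂ x - p₂' x := by
  have hβμ : 0 < β / μ := div_pos hβ hμ
  have hD₁ : ∀ y ∈ Ω, 0 ≤ N₁.dissipation μ v₁ v₁' y := fun y hy => hN₁.dissipation_nonneg hμ hy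
  have hD₂ : ∀ y ∈ Ω, 0 ≤ N₂.dissipation μ v₂ v₂' y := fun y hy => hN₂.dissipation_nonneg hμ hy
  have hq : ∀ y, 0 ≤ β / μ * ((p₁ y - p₁' y) - (p₂ y - p₂' y)) ^ 2 := fun y => by positivity
  have h_zero := divergence_eq_zero_of_nonpos hn hΩ hb hs
    ((h.flow₁.contDiffOn_energyFlux h'.flow₁).add (h.flow₂.contDiffOn_energyFlux h'.flow₂))
    ((h.flow₁.continuousOn_energyFlux h'.flow₁).add (h.flow₂.continuousOn_energyFlux h'.flow₂))
    (fun y hy => by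
      refine (h.divergence_energyFlux_add h' hN₁ hN₂ hΩ hy).trans_le (neg_nonpos.2 ?_)
      exact add_nonneg (add_nonneg (hD₁ y hy) (hD₂ y hy)) (hq y))
    (fun y ν hν => by
      rw [inner_add_left, h.flow₁.inner_energyFlux_eq_zero h'.flow₁ hN₁ hν,
        h.flow₂.inner_energyFlux_eq_zero h'.flow₂ hN₂ hν, add_zero]) hx
  have h_sum := (h.divergence_energyFlux_add h' hN₁ hN₂ hΩ hx).symm.trans h_zero
  rw [neg_eq_zero, add_eq_zero_iff_of_nonneg (add_nonneg (hD₁ x hx) (hD₂ x hx)) (hq x),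
    add_eq_zero_iff_of_nonneg (hD₁ x hx) (hD₂ x hx)] at h_sum
  obtain ⟨⟨hD₁x, hD₂x⟩, hqx⟩ := h_sum
  exact ⟨hN₁.eq_of_dissipation_eq_zero hμ hx hD₁x, hN₂.eq_of_dissipation_eq_zero hμ hx hD₂x,
    sub_eq_zero.1 (pow_eq_zero_iff two_ne_zero |>.1
      ((mul_eq_zero.1 hqx).resolve_left hβμ.ne'))⟩

end IsClassicalSolution

end Flows

end DoublePorosity

theorem mainTheorem2 {n : ℕ} (hn : 1 ≤ n)
    (Ω : Set (DoublePorosity.Space n))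
    (hΩo : IsOpen Ω) (hΩc : IsConnected Ω) (hΩb : Bornology.IsBounded Ω)
    (hΩs : DoublePorosity.HasPiecewiseSmoothBoundary Ω)
    (N₁ N₂ : DoublePorosity.Network n)
    (hN₁ : N₁.IsAdmissible Ω) (hN₂ : N₂.IsAdmissible Ω)
    (μ β γ : ℝ) (hμ : 0 < μ) (hβ : 0 < β)
    (b : DoublePorosity.Space n → DoublePorosity.Space n)
    (v₁ v₂ v₁' v₂' : DoublePorosity.Space n → DoublePorosity.Space n)
    (p₁ p₂ χ p₁' p₂' χ' : DoublePorosity.Space n → ℝ)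
    (h : DoublePorosity.IsClassicalSolution Ω N₁ N₂ μ β γ b v₁ v₂ p₁ p₂ χ)
    (h' : DoublePorosity.IsClassicalSolution Ω N₁ N₂ μ β γ b v₁' v₂' p₁' p₂' χ') :
    Set.EqOn v₁ v₁' (closure Ω) ∧ Set.EqOn v₂ v₂' (closure Ω) ∧ Set.EqOn χ χ' Ω ∧
    (∃ c : ℝ, ∀ x ∈ closure Ω, p₁ x = p₁' x + c ∧ p₂ x = p₂' x + c) ∧
    ((N₁.Γp ∪ N₂.Γp).Nonempty →
      Set.EqOn p₁ p₁' (closure Ω) ∧ Set.EqOn p₂ p₂' (closure Ω)) := by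
  have h_eq := fun x hx => h.eq_and_eq_and_sub_eq_sub h' (x := x) hn hN₁ hN₂ hμ hβ hΩo hΩb hΩs hx
  obtain ⟨c₁, hc₁⟩ := h.flow₁.exists_forall_pressure_eq_add h'.flow₁ hN₁ hΩo hΩc.isPreconnected
    fun x hx => (h_eq x hx).1
  obtain ⟨c₂, hc₂⟩ := h.flow₂.exists_forall_pressure_eq_add h'.flow₂ hN₂ hΩo hΩc.isPreconnected
    fun x hx => (h_eq x hx).2.1
  obtain rfl : c₁ = c₂ := by
    obtain ⟨x, hx⟩ := hΩc.nonempty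
    linarith [(h_eq x hx).2.2, hc₁ x (subset_closure hx), hc₂ x (subset_closure hx)]
  refine ⟨h.flow₁.eqOn_closure_of_eqOn h'.flow₁ hN₁ fun x hx => (h_eq x hx).1,
    h.flow₂.eqOn_closure_of_eqOn h'.flow₂ hN₂ fun x hx => (h_eq x hx).2.1, fun x hx => ?_,
    ⟨c₁, fun x hx => ⟨hc₁ x hx, hc₂ x hx⟩⟩, fun ⟨x, hx⟩ => ?_⟩
  · rw [h.mass_transfer x hx, h'.mass_transfer x hx, hc₁ x (subset_closure hx),
      hc₂ x (subset_closure hx), add_sub_add_right_eq_sub]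
  · obtain rfl : c₁ = 0 := hx.elim
      (fun hx => by linarith [hc₁ x (hN₁.Γp_subset_closure hx), h.flow₁.pressure_bc x hx,
        h'.flow₁.pressure_bc x hx])
      (fun hx => by linarith [hc₂ x (hN₂.Γp_subset_closure hx), h.flow₂.pressure_bc x hx,
        h'.flow₂.pressure_bc x hx])
    exact ⟨fun x hx => by rw [hc₁ x hx, add_zero], fun x hx => by rw [hc₂ x hx, add_zero]⟩
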